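/- All graphs are finite and simple, all posets are finite. **MAT-labeled complete graphs.** An edge-labeled graph $(G,\lambda)$ is a graph $G$ with vertex set $N_G$ and edge set $E_G$, together with a map $\lambda\colon E_G\to\mathbb{Z}_{>0}$. Put $\pi_k=\lambda^{-1}(k)$, $\pi_{\le k}=\pi_1\sqcup\dots\sqcup\pi_k$, and $\pi_{<k}=\pi_{\le k}\setminus\pi_k$. It is *MAT-labeled* if for every $k\ge1$: (ML1) no edge $e\in\pi_{\le k}$ forms a cycle with edges in $\pi_k$; (ML2) every edge $e\in\pi_k$ forms exactly $k-1$ triangles with edges in $\pi_{<k}$; the third vertices of these triangles are the *conditioning vertices* of $e$. A *label-preserving homomorphism* $(G,\lambda)\to(G',\lambda')$ is a map $\sigma\colon N_G\to N_{G'}$ such that $\{u,v\}\in E_G$ implies $\{\sigma(u),\sigma(v)\}\in E_{G'}$ and $\lambda'(\sigma(u),\sigma(v))=\lambda(u,v)$. Let $\mathsf{MCG}$ be the category of MAT-labeled graphs whose underlying graph is complete (the graph with no vertices included), with label-preserving homomorphisms. **Regular vines.** A poset $\mathcal P$ is *graded* if it has a rank function $\operatorname{rk}\colon\mathcal P\to\mathbb{Z}_{>0}$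 which is strictly increasing, increases by exactly $1$ along covers, and equals $1$ on all minimal elements. Let $\mathcal P_i$ be the set of elements of rank $i$, $\operatorname{rk}(\mathcal P)$ the largest rank of an element ($0$ if $\mathcal P=\varnothing$), $\dim(\mathcal P)$ the number of minimal elements, and $\mathcal E(v)$ the set of elements covered by $v$. A *vine* is a graded poset such that every non-minimal element covers exactly two elements, any two distinct elements of the same rank are covered by at most one element, and for $1\le i\le\operatorname{rk}(\mathcal P)$ the graph $F_i$ with node set $\mathcal P_i$ and edge set $\{\mathcal E(v)\mid v\in\mathcal P_{i+1}\}$ is a forest. A *regular vine* (R-vine) is a vine such that $\operatorname{rk}(\mathcal P)=\dim(\mathcal P)$, each $F_i$ ($1\le i\le\operatorname{rk}(\mathcal P)$) is a tree, and any two distinct elements of the same rank $i\ge2$ that are covered by a common element cover a common element. Let $\mathsf{RV}$ be the category of R-vines (the empty one included), whose morphisms are the order-preserving maps $\varphi$ that preserve rank and joins (if $x\vee y$ exists, then $\varphi(x)\vee\varphi(y)$ exists and equals $\varphi(x\vee y)$). **The construction $\Psi$.** The *principal clique* $K_e$ generated by an edge $e$ consists of the end vertices and the conditioning vertices of $e$.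 Let $\Psi(G,\lambda)$ be the set of all $\{a\}$, $a\in N_G$, and all $K_e$, $e\in E_G$, ordered by inclusion, with rank function $v\mapsto|v|$. For a label-preserving homomorphism $\sigma$ let $\Psi(\sigma)(v)=\{\sigma(a)\mid a\in v\}$. **The construction $\Omega$.** Let $\Omega(\mathcal P)$ be the edge-labeled graph whose vertices are the minimal elements of $\mathcal P$, in which distinct $i,j$ are adjacent if and only if the join $i\vee j$ exists in $\mathcal P$, with label $\lambda(i,j)=\operatorname{rk}(i\vee j)-1$. For a morphism $\varphi$ let $\Omega(\varphi)$ be the restriction of $\varphi$ to minimal elements. **Corollary.** $\Psi$ restricts to a well-defined functor $\Psi|_{\mathsf{MCG}}\colon\mathsf{MCG}\to\mathsf{RV}$ and $\Omega$ restricts to a well-defined functor $\Omega|_{\mathsf{RV}}\colon\mathsf{RV}\to\mathsf{MCG}$. The composite functor $\Psi|_{\mathsf{MCG}}\,\Omega|_{\mathsf{RV}}$ is naturally isomorphic to the identity functor $1_{\mathsf{RV}}$, and $\Omega|_{\mathsf{RV}}\,\Psi|_{\mathsf{MCG}}$ is naturally isomorphic to $1_{\mathsf{MCG}}$. As a result,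 the categories $\mathsf{MCG}$ and $\mathsf{RV}$ are equivalent. -/

import Mathlib

open CategoryTheory

universe u

/-! ### Edge-labeled graphs -/

/-- A finite simple graph together with a labeling of its edges by natural numbers.
(Labels of the MAT-labeled graphs below are required to be positive.) -/
structure LabeledGraph : Type (u + 1) where
  V : Type u
  finite : Finite V
  graph : SimpleGraph V
  label : graph.edgeSet → ℕ

namespace LabeledGraph

/-- The graph on the vertices of `G` whose edges are the edges of `G` with label satisfying `p`. -/
def edgesWith (G : LabeledGraph.{u}) (p : ℕ → Prop) : SimpleGraph G.V :=
  SimpleGraph.fromEdgeSet {e | ∃ h : e ∈ G.graph.edgeSet, p (G.label ⟨e, h⟩)}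

/-- The edges of label `k`. -/
def level (G : LabeledGraph.{u}) (k : ℕ) : SimpleGraph G.V := G.edgesWith (fun m => m = k)

/-- The edges of label `< k`. -/
def below (G : LabeledGraph.{u}) (k : ℕ) : SimpleGraph G.V := G.edgesWith (fun m => m < k)

/-- The edges of label `≤ k`. -/
def upTo (G : LabeledGraph.{u}) (k : ℕ) : SimpleGraph G.V := G.edgesWith (fun m => m ≤ k)

/-- The vertices forming with `a` and `b` two edges of label `< k`; if `{a, b}` is an edge of
label `k`, these are its conditioning vertices. -/
def condVertices (G : LabeledGraph.{u}) (k : ℕ) (a b : G.V) : Set G.V :=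
  {h | (G.below k).Adj a h ∧ (G.below k).Adj h b}

/-- The labeling of `G` is an MAT-labeling. -/
structure IsMAT (G : LabeledGraph.{u}) : Prop where
  label_pos : ∀ e, 0 < G.label e
  /-- An edge of label `≤ k` does not form a cycle with edges of label `k`. -/
  no_cycle : ∀ k, 0 < k → ∀ a b, (G.upTo k).Adj a b →
    ∀ (w : G.V) (c : (G.level k ⊔ SimpleGraph.edge a b).Walk w w), c.IsCycle → s(a, b) ∉ c.edges
  /-- An edge of label `k` forms exactly `k - 1` triangles with edges of label `< k`. -/
  triangles : ∀ k, 0 < k → ∀ a b, (G.level k).Adj a b → (G.condVertices k a b).ncard = k - 1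

/-- A label-preserving homomorphism. -/
@[ext]
structure Hom (G H : LabeledGraph.{u}) : Type u where
  toFun : G.V → H.V
  map_edge : ∀ a b (h : G.graph.Adj a b), ∃ h' : H.graph.Adj (toFun a) (toFun b),
    H.label ⟨s(toFun a, toFun b), h'⟩ = G.label ⟨s(a, b), h⟩

/-- Edge-labeled graphs and label-preserving homomorphisms. -/
instance : Category LabeledGraph.{u} where
  Hom := Hom
  id G := { toFun := id, map_edge := fun _ _ h => ⟨h, rfl⟩ }
  comp f g :=
    { toFun := g.toFun ∘ f.toFun
      map_edge := fun a b h => by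
        obtain ⟨h₁, e₁⟩ := f.map_edge a b h
        obtain ⟨h₂, e₂⟩ := g.map_edge _ _ h₁
        exact ⟨h₂, e₂.trans e₁⟩ }

end LabeledGraph

/-- The property defining the category of MAT-labeled complete graphs, as a full subcategory of
edge-labeled graphs. The graph without vertices is complete. -/
def MCG : ObjectProperty LabeledGraph.{u} := fun G => G.graph = ⊤ ∧ G.IsMAT

/-! ### Vines -/

/-- `rk` is a rank function making the poset `P` graded, with minimal elements of rank one. -/
structure IsRankFunction {P : Type u} [PartialOrder P] (rk : P → ℕ) : Prop where
  lt : ∀ x y, x < y → rk x < rk y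
  covBy : ∀ x y, x ⋖ y → rk x + 1 = rk y
  isMin : ∀ x, IsMin x → rk x = 1

/-- The set of elements covered by `v`. -/
def coveredBy {P : Type u} [PartialOrder P] (v : P) : Set P := {x | x ⋖ v}

/-- The `i`-th associated graph: its nodes are the elements of rank `i`, its edges are the sets of
elements covered by an element of rank `i + 1`. -/
def assocGraph {P : Type u} [PartialOrder P] (rk : P → ℕ) (i : ℕ) :
    SimpleGraph {x : P // rk x = i} where
  Adj a b := a ≠ b ∧ ∃ v : P, rk v = i + 1 ∧ coveredBy v = {a.1, b.1}
  symm := ⟨fun _ _ h => ⟨h.1.symm, h.2.imp fun _ hv => ⟨hv.1, hv.2.trans (Set.pair_comm _ _)⟩⟩⟩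
  loopless := ⟨fun _ h => h.1 rfl⟩

/-- The largest rank of an element (zero for the empty poset). -/
noncomputable def posetRank {P : Type u} (rk : P → ℕ) : ℕ := sSup (Set.range rk)

/-- The number of minimal elements. -/
noncomputable def posetDim (P : Type u) [PartialOrder P] : ℕ := {x : P | IsMin x}.ncard

/-- The poset `P` with rank function `rk` is a vine. -/
structure IsVine {P : Type u} [PartialOrder P] (rk : P → ℕ) : Prop where
  graded : IsRankFunction rk
  covers_two : ∀ v : P, ¬ IsMin v → (coveredBy v).ncard = 2
  covered_once : ∀ a b : P, a ≠ b → rk a = rk b →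
    ∀ v w : P, a ⋖ v → b ⋖ v → a ⋖ w → b ⋖ w → v = w
  forest : ∀ i, 1 ≤ i → i ≤ posetRank rk → (assocGraph rk i).IsAcyclic

/-- The poset `P` with rank function `rk` is a regular vine. -/
structure IsRVine {P : Type u} [PartialOrder P] (rk : P → ℕ) : Prop where
  vine : IsVine rk
  rank_eq_dim : posetRank rk = posetDim P
  tree : ∀ i, 1 ≤ i → i ≤ posetRank rk → (assocGraph rk i).IsTree
  proximity : ∀ i, 2 ≤ i → ∀ a b : P, a ≠ b → rk a = i → rk b = i →
    (∃ v, a ⋖ v ∧ b ⋖ v) → ∃ w, w ⋖ a ∧ w ⋖ b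

/-- A finite poset equipped with a function to the natural numbers. -/
structure RankedPoset : Type (u + 1) where
  P : Type u
  order : PartialOrder P
  finite : Finite P
  rk : P → ℕ

attribute [instance] RankedPoset.order

namespace RankedPoset

/-- A poset homomorphism preserving rank and join. -/
@[ext]
structure Hom (P Q : RankedPoset.{u}) : Type u where
  toFun : P.P → Q.P
  monotone : Monotone toFun
  map_rk : ∀ x, Q.rk (toFun x) = P.rk x
  map_join : ∀ x y v, IsLUB {x, y} v → IsLUB {toFun x, toFun y} (toFun v)

/-- Finite posets with a function to the natural numbers, and homomorphisms preserving rank and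
join. -/
instance : Category RankedPoset.{u} where
  Hom := Hom
  id P :=
    { toFun := id
      monotone := monotone_id
      map_rk := fun _ => rfl
      map_join := fun _ _ _ h => h }
  comp f g :=
    { toFun := g.toFun ∘ f.toFun
      monotone := g.monotone.comp f.monotone
      map_rk := fun x => (g.map_rk _).trans (f.map_rk x)
      map_join := fun x y v h => g.map_join _ _ _ (f.map_join x y v h) }

end RankedPoset

/-- The property defining the category of R-vines, as a full subcategory. -/
def RV : ObjectProperty RankedPoset.{u} := fun P => IsRVine P.rk

/-! ### The construction `Ψ`, from labeled graphs to posets -/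

/-- For an edge `{a, b}` of label `k`: the principal clique generated by `{a, b}`, consisting of
its end vertices and its conditioning vertices. -/
def LabeledGraph.principalClique (G : LabeledGraph.{u}) (k : ℕ) (a b : G.V) : Set G.V :=
  {a, b} ∪ G.condVertices k a b

/-- The nodes of `Ψ(G)`: the one-vertex sets and the principal cliques. -/
def LabeledGraph.IsNode (G : LabeledGraph.{u}) (s : Set G.V) : Prop :=
  (∃ a, s = {a}) ∨ ∃ k a b, (G.level k).Adj a b ∧ s = G.principalClique k a b

/-- `Ψ` on objects: the nodes ordered by inclusion, the rank being the cardinality. -/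
noncomputable def psiObj (G : LabeledGraph.{u}) : RankedPoset.{u} where
  P := {s : Set G.V // G.IsNode s}
  order := inferInstance
  finite := by
    have := G.finite
    infer_instance
  rk s := s.1.ncard

/-- `Ψ` restricts to a functor between the full subcategories given by `C` and `D`: it sends the
objects of `C` to objects of `D`, and for each label-preserving homomorphism `σ` between objects of
`C` the map `s ↦ σ(s)` is a well-defined homomorphism preserving rank and join. -/
structure PsiRestricts (C : ObjectProperty LabeledGraph.{u}) (D : ObjectProperty RankedPoset.{u}) :
    Prop where
  obj : ∀ G, C G → D (psiObj G)
  map : ∀ G H, C G → C H → ∀ σ : LabeledGraph.Hom G H,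
    ∃ φ : RankedPoset.Hom (psiObj G) (psiObj H), ∀ s, (φ.toFun s).1 = σ.toFun '' s.1

/-- The restriction of `Ψ`, as a functor. -/
noncomputable def PsiRestricts.functor {C : ObjectProperty LabeledGraph.{u}}
    {D : ObjectProperty RankedPoset.{u}} (h : PsiRestricts C D) :
    C.FullSubcategory ⥤ D.FullSubcategory where
  obj G := ⟨psiObj G.obj, h.obj G.obj G.property⟩
  map {G H} σ := ObjectProperty.homMk (h.map G.obj H.obj G.property H.property σ.hom).choose
  map_id G := by
    apply ObjectProperty.hom_ext
    apply RankedPoset.Hom.ext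
    funext s
    apply Subtype.ext
    refine ((h.map G.obj G.obj G.property G.property (𝟙 G.obj)).choose_spec s).trans ?_
    exact Set.image_id _
  map_comp {G H K} σ τ := by
    apply ObjectProperty.hom_ext
    apply RankedPoset.Hom.ext
    funext s
    apply Subtype.ext
    have h₁ := (h.map G.obj H.obj G.property H.property σ.hom).choose_spec s
    have h₂ := (h.map H.obj K.obj H.property K.property τ.hom).choose_spec
      ((h.map G.obj H.obj G.property H.property σ.hom).choose.toFun s)
    refine ((h.map G.obj K.obj G.property K.property (σ.hom ≫ τ.hom)).choose_spec s).trans ?_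
    refine Eq.trans ?_ h₂.symm
    rw [h₁]
    exact Set.image_comp τ.hom.toFun σ.hom.toFun s.1

/-! ### The construction `Ω`, from posets to labeled graphs -/

/-- The graph of `Ω(P)`: the vertices are the minimal elements, two distinct ones being adjacent
when their join exists. -/
def omegaGraph (P : RankedPoset.{u}) : SimpleGraph {x : P.P // IsMin x} where
  Adj i j := i ≠ j ∧ ∃ v : P.P, IsLUB {i.1, j.1} v
  symm := ⟨fun i j h => ⟨h.1.symm, by rw [Set.pair_comm]; exact h.2⟩⟩
  loopless := ⟨fun _ h => h.1 rfl⟩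

theorem omegaGraph_exists_join (P : RankedPoset.{u}) (e : Sym2 {x : P.P // IsMin x})
    (he : e ∈ (omegaGraph P).edgeSet) : ∃ v : P.P, IsLUB {x | ∃ i ∈ e, i.1 = x} v := by
  induction e with
  | h i j =>
    obtain ⟨v, hv⟩ := (SimpleGraph.mem_edgeSet _).1 he |>.2
    refine ⟨v, ?_⟩
    convert hv using 1
    ext x
    simp [eq_comm]

/-- `Ω` on objects: the label of an edge `{i, j}` is the rank of the join of `i` and `j`, minus
one. -/
noncomputable def omegaObj (P : RankedPoset.{u}) : LabeledGraph.{u} where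
  V := {x : P.P // IsMin x}
  finite := by
    have := P.finite
    infer_instance
  graph := omegaGraph P
  label e := P.rk (omegaGraph_exists_join P e.1 e.2).choose - 1

/-- `Ω` restricts to a functor between the full subcategories given by `D` and `C`: it sends the
objects of `D` to objects of `C`, and each homomorphism `φ` between objects of `D` preserving rank
and join sends minimal elements to minimal elements, the map `i ↦ φ(i)` on minimal elements being
a label-preserving homomorphism. -/
structure OmegaRestricts (D : ObjectProperty RankedPoset.{u})
    (C : ObjectProperty LabeledGraph.{u}) : Prop where
  obj : ∀ P, D P → C (omegaObj P)
  map : ∀ P Q, D P → D Q → ∀ φ : RankedPoset.Hom P Q,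
    ∃ σ : LabeledGraph.Hom (omegaObj P) (omegaObj Q), ∀ i, (σ.toFun i).1 = φ.toFun i.1

/-- The restriction of `Ω`, as a functor. -/
noncomputable def OmegaRestricts.functor {D : ObjectProperty RankedPoset.{u}}
    {C : ObjectProperty LabeledGraph.{u}} (h : OmegaRestricts D C) :
    D.FullSubcategory ⥤ C.FullSubcategory where
  obj P := ⟨omegaObj P.obj, h.obj P.obj P.property⟩
  map {P Q} φ := ObjectProperty.homMk (h.map P.obj Q.obj P.property Q.property φ.hom).choose
  map_id P := by
    apply ObjectProperty.hom_ext
    apply LabeledGraph.Hom.ext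
    funext i
    apply Subtype.ext
    exact (h.map P.obj P.obj P.property P.property (𝟙 P.obj)).choose_spec i
  map_comp {P Q R} φ ψ := by
    apply ObjectProperty.hom_ext
    apply LabeledGraph.Hom.ext
    funext i
    apply Subtype.ext
    have h₁ := (h.map P.obj Q.obj P.property Q.property φ.hom).choose_spec i
    have h₂ := (h.map Q.obj R.obj Q.property R.property ψ.hom).choose_spec
      ((h.map P.obj Q.obj P.property Q.property φ.hom).choose.toFun i)
    refine ((h.map P.obj R.obj P.property R.property (φ.hom ≫ ψ.hom)).choose_spec i).trans ?_
    refine Eq.trans ?_ h₂.symm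
    rw [h₁]
    rfl

/-!
The singletons and principal cliques of an MAT-labeled complete graph, ordered by inclusion, form a
regular vine. Conversely an element of a regular vine is determined by the minimal elements below
it, and these sets are the singletons and principal cliques of the graph labeled by ranks of joins.

*From labels to vines.* The point to be shown is that in an MAT-labeled complete graph a principal
clique `K_e` contains the principal clique of each of its edges. For this, the graph of the edges
with label `< k` is shown to be chordal for every `k` (`IsMATLabeling.chordal`), by adding the edges
of label `k` one at a time. A new edge `{u, v}` preserves chordality if its `k - 1` conditioning
vertices separate `u` from `v` (`SimpleGraph.Chordal.sup_edge`). Otherwise chordality provides a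
path from `u` to `v` through common neighbours of the conditioning vertices. The conditioning
vertices form with any edge of this path a clique of `k + 1` vertices and labels at most `k`, and
such a clique contains an edge of label `k`, which generates it. Comparing these generating edges
along the path, one finds that all edges of the path have label `k`, so that together with `{u, v}`
they form a forbidden cycle (`IsMATLabeling.levelGraph_reachable_of_path`). Chordality makes the
conditioning vertices of an edge a clique of smaller labels, and it follows that the nodes of `Ψ`
are the nonempty sets of vertices closed under taking conditioning vertices
(`IsMATLabeling.isClosedSet_and_nonempty_iff`). Closed sets are stable under intersection, and a
closed set `K_e`, `e = {a, b}`, has exactly two maximal closed proper subsets, `K_e \ {a}` and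
`K_e \ {b}` (`IsMATLabeling.exists_diff_of_isClosedSet`). The axioms of a regular vine follow; the
associated graphs are trees because they are connected and have the right number of edges
(`IsMATLabeling.isRVine_node`).

*From vines to labels.* In a regular vine an element of rank `r` has exactly `r` minimal elements
below it: along a maximal chain this number grows by at most one in each step, and rank and
dimension agree at the greatest element (`IsRVine.ncard_minsBelow`). Any two minimal elements have a
join (`IsRVine.exists_isLUB`), and the conditioning vertices of `{i, j}` are the other minimal
elements below `i ∨ j` (`IsRVine.condSet_joinLabel`). The labeling has no forbidden cycles since
every set of vertices contains a vertex at which all triangles of the set have their largest label,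
attained once (`HasEliminationVertices.mem_edges_of_isPath`).

*The equivalence.* Label-preserving homomorphisms are injective and map principal cliques onto
principal cliques, and preimages of closed sets are closed, so that joins are preserved. The
natural isomorphisms are `a ↦ {a}` and `v ↦ minsBelow v`.
-/

/-! ### Chordal graphs -/

namespace SimpleGraph

variable {V : Type*}

/-- Every walk from `x` to `y` that avoids the edge `{x, y}` passes through a common neighbour of
`x` and `y`. -/
def SepByCommonNbrs (G : SimpleGraph V) (x y : V) : Prop :=
  ∀ p : G.Walk x y, s(x, y) ∉ p.edges → ∃ z ∈ p.support, G.Adj x z ∧ G.Adj z y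

/-- Chordality of a graph, in the following form: every edge becomes a bridge once the common
neighbours of its ends are deleted. Equivalently, every cycle has length three or a chord. -/
def Chordal (G : SimpleGraph V) : Prop := ∀ x y, G.Adj x y → G.SepByCommonNbrs x y

theorem SepByCommonNbrs.symm {G : SimpleGraph V} {x y : V} (h : G.SepByCommonNbrs x y) :
    G.SepByCommonNbrs y x := by
  intro p hp
  obtain ⟨z, hz, h₁, h₂⟩ := h p.reverse (by simpa [Sym2.eq_swap] using hp)
  exact ⟨z, by simpa using hz, h₂.symm, h₁.symm⟩

/-- In a chordal graph, if `a` and `u` are adjacent to `h` and joined by a walk avoiding `h`, then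
they are joined by a walk inside the neighbourhood of `h`, whose vertices are on the given walk. -/
theorem Chordal.exists_walk_in_nbhd {G : SimpleGraph V} (hG : G.Chordal) {h u : V}
    (hu : G.Adj u h) {a : V} (ha : G.Adj a h) (p : G.Walk a u) (hp : h ∉ p.support) :
    ∃ q : G.Walk a u, ∀ w ∈ q.support, w ∈ p.support ∧ G.Adj w h := by
  classical
  obtain ⟨n, hn⟩ : ∃ n, p.length = n := ⟨_, rfl⟩
  induction n using Nat.strong_induction_on generalizing a with
  | _ n ih =>
    by_cases hau : a = u
    · subst hau
      exact ⟨.nil, by simpa using ha⟩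
    obtain ⟨z, hz, hz₁, hz₂⟩ := hG a h ha (p.concat hu) (by
      rw [Walk.edges_concat]
      simp only [List.concat_eq_append, List.mem_append, List.mem_singleton]
      rintro (h₁ | h₁)
      · exact hp (p.snd_mem_support_of_mem_edges h₁)
      · simp only [Sym2.eq_iff] at h₁
        rcases h₁ with h₁ | h₁
        · exact hau h₁.1
        · exact ha.ne h₁.1)
    have hzp : z ∈ p.support := by
      simp only [Walk.support_concat, List.mem_append, List.mem_singleton] at hz
      exact hz.resolve_right hz₂.ne
    have hsub := p.support_dropUntil_subset_support hzp
    obtain ⟨q, hq⟩ := ih _ (hn ▸ Walk.length_dropUntil_lt_length hzp hz₁.ne') hz₂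
      (p.dropUntil z hzp) (fun h' => hp (hsub h')) rfl
    refine ⟨.cons hz₁ q, fun w hw => ?_⟩
    rw [Walk.support_cons, List.mem_cons] at hw
    rcases hw with rfl | hw
    · exact ⟨p.start_mem_support, ha⟩
    · exact ⟨hsub (hq w hw).1, (hq w hw).2⟩

/-- The same for finitely many common neighbours `h ∈ S` of the end vertices. -/
theorem Chordal.exists_walk_in_common_nbhd {G : SimpleGraph V} (hG : G.Chordal) {u a : V}
    (S : Finset V) (hu : ∀ h ∈ S, G.Adj u h) (ha : ∀ h ∈ S, G.Adj a h) (p : G.Walk a u)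
    (hp : ∀ h ∈ S, h ∉ p.support) :
    ∃ q : G.Walk a u, ∀ w ∈ q.support, w ∈ p.support ∧ ∀ h ∈ S, G.Adj w h := by
  classical
  induction S using Finset.induction_on with
  | empty => exact ⟨p, by simp⟩
  | insert h S hS ih =>
    obtain ⟨q, hq⟩ := ih (fun x hx => hu x (Finset.mem_insert_of_mem hx))
      (fun x hx => ha x (Finset.mem_insert_of_mem hx))
      (fun x hx => hp x (Finset.mem_insert_of_mem hx))
    obtain ⟨r, hr⟩ := hG.exists_walk_in_nbhd (hu h (Finset.mem_insert_self _ _))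
      (ha h (Finset.mem_insert_self _ _)) q
      (fun h' => hp h (Finset.mem_insert_self _ _) (hq h h').1)
    refine ⟨r, fun w hw => ⟨(hq w (hr w hw).1).1, fun x hx => ?_⟩⟩
    rcases Finset.mem_insert.1 hx with rfl | hx
    · exact (hr w hw).2
    · exact (hq w (hr w hw).1).2 x hx

/-- A walk in `G` with one more edge `{u, v}` is a walk in `G`, or contains walks in `G` leading
from its start to one end of the new edge and from the other end of that edge to its end. -/
theorem Walk.split_sup_edge {G : SimpleGraph V} {u v x y : V} (p : (G ⊔ edge u v).Walk x y) :
    (∃ q : G.Walk x y, q.support ⊆ p.support ∧ q.edges ⊆ p.edges) ∨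
    (∃ (q : G.Walk x u) (r : G.Walk v y), (q.support ⊆ p.support ∧ q.edges ⊆ p.edges) ∧
      r.support ⊆ p.support ∧ r.edges ⊆ p.edges) ∨
    (∃ (q : G.Walk x v) (r : G.Walk u y), (q.support ⊆ p.support ∧ q.edges ⊆ p.edges) ∧
      r.support ⊆ p.support ∧ r.edges ⊆ p.edges) := by
  induction p with
  | nil => exact Or.inl ⟨.nil, by simp⟩
  | @cons x w y h p ih =>
    simp only [Walk.support_cons, Walk.edges_cons]
    have aux' : ∀ {s t : V} (r : G.Walk s t), r.support ⊆ p.support ∧ r.edges ⊆ p.edges →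
        r.support ⊆ x :: p.support ∧ r.edges ⊆ s(x, w) :: p.edges := fun r hr =>
      ⟨List.subset_cons_of_subset _ hr.1, List.subset_cons_of_subset _ hr.2⟩
    by_cases hxw : G.Adj x w
    · have aux : ∀ {z : V} (q : G.Walk w z), q.support ⊆ p.support ∧ q.edges ⊆ p.edges →
          (Walk.cons hxw q).support ⊆ x :: p.support ∧
            (Walk.cons hxw q).edges ⊆ s(x, w) :: p.edges := fun q hq =>
        ⟨by simpa using List.cons_subset_cons _ hq.1, by simpa using List.cons_subset_cons _ hq.2⟩
      rcases ih with ⟨q, hq⟩ | ⟨q, r, hq, hr⟩ | ⟨q, r, hq, hr⟩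
      · exact Or.inl ⟨_, aux q hq⟩
      · exact Or.inr (Or.inl ⟨_, r, aux q hq, aux' _ hr⟩)
      · exact Or.inr (Or.inr ⟨_, r, aux q hq, aux' _ hr⟩)
    · have h' := h
      rw [sup_adj, edge_adj] at h'
      rcases (h'.resolve_left hxw).1 with ⟨rfl, rfl⟩ | ⟨rfl, rfl⟩
      · rcases ih with ⟨q, hq⟩ | ⟨q, r, hq, hr⟩ | ⟨q, r, hq, hr⟩
        · exact Or.inr (Or.inl ⟨.nil, q, ⟨by simp, by simp⟩,
            aux' _ hq⟩)
        · exact Or.inr (Or.inl ⟨.nil, r, ⟨by simp, by simp⟩,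
            aux' _ hr⟩)
        · exact Or.inl ⟨r, aux' _ hr⟩
      · rcases ih with ⟨q, hq⟩ | ⟨q, r, hq, hr⟩ | ⟨q, r, hq, hr⟩
        · exact Or.inr (Or.inr ⟨.nil, q, ⟨by simp, by simp⟩,
            aux' _ hq⟩)
        · exact Or.inl ⟨r, aux' _ hr⟩
        · exact Or.inr (Or.inr ⟨.nil, r, ⟨by simp, by simp⟩,
            aux' _ hr⟩)

/-- The rerouting step of `Chordal.sup_edge`: a walk through the new edge `{u, v}` meets a common
neighbour `h` of `u` and `v`, and a detour through `h` avoids the new edge. -/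
theorem Chordal.not_walk_through_edge {G : SimpleGraph V} (hG : G.Chordal) {u v x y : V}
    (huv : u ≠ v) (hsep : ∀ p : G.Walk v u, ∃ z ∈ p.support, G.Adj u z ∧ G.Adj z v)
    (hxy : G.Adj x y) (q : G.Walk x u) (r : G.Walk v y)
    (hqe : s(x, y) ∉ q.edges) (hre : s(x, y) ∉ r.edges)
    (hq : ∀ z ∈ q.support, ¬ ((G ⊔ edge u v).Adj x z ∧ (G ⊔ edge u v).Adj z y))
    (hr : ∀ z ∈ r.support, ¬ ((G ⊔ edge u v).Adj x z ∧ (G ⊔ edge u v).Adj z y)) : False := by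
  classical
  have huv' : (G ⊔ edge u v).Adj u v := by simp [edge_adj, huv]
  have hle : ∀ {a b}, G.Adj a b → (G ⊔ edge u v).Adj a b := fun h => Or.inl h
  obtain ⟨h, hh, hu, hv⟩ := hsep (r.append (.cons hxy.symm q))
  rw [Walk.mem_support_append_iff, Walk.support_cons, List.mem_cons] at hh
  have hh' : h ∈ r.support ∨ h ∈ q.support := by
    rcases hh with hh | rfl | hh
    · exact Or.inl hh
    · exact Or.inl r.end_mem_support
    · exact Or.inr hh
  rcases hh' with hh | hh
  · -- `h` lies on the walk from `v` to `y`: go from `u` to `h` directly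
    obtain ⟨z, hz, h₁, h₂⟩ := hG x y hxy (q.append (.cons hu (r.dropUntil h hh))) (by
      rw [Walk.edges_append, Walk.edges_cons, List.mem_append, List.mem_cons]
      rintro (h₁ | h₁ | h₁)
      · exact hqe h₁
      · rw [Sym2.eq_iff] at h₁
        rcases h₁ with ⟨rfl, rfl⟩ | ⟨rfl, rfl⟩
        · exact hr v r.start_mem_support ⟨huv', hle hv.symm⟩
        · exact hr v r.start_mem_support ⟨hle hv, huv'.symm⟩
      · exact hre (r.edges_dropUntil_subset_edges hh h₁))
    rw [Walk.mem_support_append_iff, Walk.support_cons, List.mem_cons] at hz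
    rcases hz with hz | rfl | hz
    · exact hq z hz ⟨hle h₁, hle h₂⟩
    · exact hq _ q.end_mem_support ⟨hle h₁, hle h₂⟩
    · exact hr z (r.support_dropUntil_subset_support hh hz) ⟨hle h₁, hle h₂⟩
  · obtain ⟨z, hz, h₁, h₂⟩ := hG x y hxy ((q.takeUntil h hh).append (.cons hv r)) (by
      rw [Walk.edges_append, Walk.edges_cons, List.mem_append, List.mem_cons]
      rintro (h₁ | h₁ | h₁)
      · exact hqe (q.edges_takeUntil_subset_edges hh h₁)
      · rw [Sym2.eq_iff] at h₁
        rcases h₁ with ⟨rfl, rfl⟩ | ⟨rfl, rfl⟩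
        · exact hq u q.end_mem_support ⟨hle hu.symm, huv'⟩
        · exact hq u q.end_mem_support ⟨huv'.symm, hle hu⟩
      · exact hre h₁)
    rw [Walk.mem_support_append_iff, Walk.support_cons, List.mem_cons] at hz
    rcases hz with hz | rfl | hz
    · exact hq z (q.support_takeUntil_subset_support hh hz) ⟨hle h₁, hle h₂⟩
    · exact hq _ hh ⟨hle h₁, hle h₂⟩
    · exact hr z hz ⟨hle h₁, hle h₂⟩

/-- Adding an edge `{u, v}` to a chordal graph preserves chordality when the common neighbours of
`u` and `v` separate `u` from `v`. -/
theorem Chordal.sup_edge {G : SimpleGraph V} (hG : G.Chordal) {u v : V} (huv : u ≠ v)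
    (hsep : ∀ p : G.Walk u v, ∃ z ∈ p.support, G.Adj u z ∧ G.Adj z v) :
    (G ⊔ edge u v).Chordal := by
  classical
  have hle : ∀ {a b}, G.Adj a b → (G ⊔ edge u v).Adj a b := fun h => Or.inl h
  have hsep' : ∀ p : G.Walk v u, ∃ z ∈ p.support, G.Adj u z ∧ G.Adj z v := fun p => by
    simpa using hsep p.reverse
  have key : (G ⊔ edge u v).SepByCommonNbrs u v := by
    intro p hp
    obtain ⟨z, hz, h₁, h₂⟩ := hsep (p.transfer G (fun e he => by
      have h' := p.edges_subset_edgeSet he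
      induction e with
      | h a b =>
        rw [mem_edgeSet, sup_adj, edge_adj] at h'
        rcases h' with h' | ⟨⟨rfl, rfl⟩ | ⟨rfl, rfl⟩, -⟩
        · exact h'
        · exact absurd he hp
        · exact absurd he (by rwa [Sym2.eq_swap])))
    exact ⟨z, by simpa using hz, hle h₁, hle h₂⟩
  intro x y hxy p hp
  by_cases hxyG : G.Adj x y
  · by_contra! hno
    have hno' : ∀ z ∈ p.support, ¬ ((G ⊔ edge u v).Adj x z ∧ (G ⊔ edge u v).Adj z y) :=
      fun z hz h => hno z hz h.1 h.2
    rcases p.split_sup_edge with ⟨q, hq⟩ | ⟨q, r, hq, hr⟩ | ⟨q, r, hq, hr⟩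
    · obtain ⟨z, hz, h₁, h₂⟩ := hG x y hxyG q (fun h => hp (hq.2 h))
      exact hno z (hq.1 hz) (hle h₁) (hle h₂)
    · exact hG.not_walk_through_edge huv hsep' hxyG q r (fun h => hp (hq.2 h))
        (fun h => hp (hr.2 h)) (fun z hz => hno' z (hq.1 hz)) (fun z hz => hno' z (hr.1 hz))
    · refine hG.not_walk_through_edge huv.symm ?_ hxyG q r (fun h => hp (hq.2 h))
        (fun h => hp (hr.2 h)) ?_ ?_
      · intro p
        obtain ⟨z, hz, h₁, h₂⟩ := hsep p
        exact ⟨z, hz, h₂.symm, h₁.symm⟩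
      · rw [edge_comm]; exact fun z hz => hno' z (hq.1 hz)
      · rw [edge_comm]; exact fun z hz => hno' z (hr.1 hz)
  · rw [sup_adj, edge_adj] at hxy
    rcases (hxy.resolve_left hxyG).1 with ⟨rfl, rfl⟩ | ⟨rfl, rfl⟩
    · exact key p hp
    · exact key.symm p hp

end SimpleGraph

/-! ### Labelings of complete graphs -/

section Labeling

open SimpleGraph

variable {V : Type*}

/-- The edges `{a, b}` of the complete graph with label `l a b = k`. -/
def levelGraph (l : V → V → ℕ) (hl : ∀ a b, l a b = l b a) (k : ℕ) : SimpleGraph V where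
  Adj a b := a ≠ b ∧ l a b = k
  symm := ⟨fun a b h => ⟨h.1.symm, hl a b ▸ h.2⟩⟩
  loopless := ⟨fun _ h => h.1 rfl⟩

/-- The edges `{a, b}` of the complete graph with label `l a b < k`. -/
def ltGraph (l : V → V → ℕ) (hl : ∀ a b, l a b = l b a) (k : ℕ) : SimpleGraph V where
  Adj a b := a ≠ b ∧ l a b < k
  symm := ⟨fun a b h => ⟨h.1.symm, hl a b ▸ h.2⟩⟩
  loopless := ⟨fun _ h => h.1 rfl⟩

/-- The conditioning vertices of the edge `{a, b}`. -/
def condSet (l : V → V → ℕ) (a b : V) : Set V := {h | l a h < l a b ∧ l h b < l a b}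

/-- The principal clique generated by the edge `{a, b}`. -/
def pclique (l : V → V → ℕ) (a b : V) : Set V := {a, b} ∪ condSet l a b

/-- An MAT-labeling of the complete graph on `V`, as a symmetric function on pairs of vertices that
vanishes on the diagonal. That an edge of label at most `k` forms no cycle with edges of label `k`
is expressed by saying that such edges do not connect its ends. -/
structure IsMATLabeling (l : V → V → ℕ) : Prop where
  symm : ∀ a b, l a b = l b a
  self : ∀ a, l a a = 0
  pos : ∀ a b, a ≠ b → 0 < l a b
  not_reachable : ∀ k a b, a ≠ b → l a b ≤ k →
    ¬ ((levelGraph l symm k).deleteEdges {s(a, b)}).Reachable a b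
  ncard_condSet : ∀ a b, a ≠ b → (condSet l a b).ncard = l a b - 1

namespace IsMATLabeling

variable {l : V → V → ℕ}

theorem condSet_symm (hl : IsMATLabeling l) (a b : V) : condSet l a b = condSet l b a := by
  ext h
  simp only [condSet, Set.mem_ofPred_eq]
  rw [hl.symm a h, hl.symm h b, hl.symm a b, and_comm]

theorem pclique_symm (hl : IsMATLabeling l) (a b : V) : pclique l a b = pclique l b a := by
  rw [pclique, pclique, hl.condSet_symm, Set.pair_comm]

theorem left_notMem_condSet (a b : V) : a ∉ condSet l a b := fun h => lt_irrefl _ h.2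

theorem right_notMem_condSet (a b : V) : b ∉ condSet l a b := fun h => lt_irrefl _ h.1

theorem left_mem_pclique (a b : V) : a ∈ pclique l a b := Or.inl (Or.inl rfl)

theorem right_mem_pclique (a b : V) : b ∈ pclique l a b := Or.inl (Or.inr rfl)

theorem condSet_subset_pclique (a b : V) : condSet l a b ⊆ pclique l a b :=
  Set.subset_union_right

theorem ncard_pclique [Finite V] (hl : IsMATLabeling l) {a b : V} (hab : a ≠ b) :
    (pclique l a b).ncard = l a b + 1 := by
  rw [pclique, Set.ncard_union_eq, Set.ncard_pair hab, hl.ncard_condSet a b hab]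
  · have := hl.pos a b hab
    omega
  · rw [Set.disjoint_left]
    rintro x (rfl | rfl)
    · exact left_notMem_condSet _ _
    · exact right_notMem_condSet _ _

/-- The largest label in a triangle is attained only once. -/
theorem lt_of_eq (hl : IsMATLabeling l) {a b c : V} (hab : a ≠ b) (hac : a ≠ c) (hbc : b ≠ c)
    (h : l a b = l a c) : l a b < l b c := by
  by_contra! hle
  refine hl.not_reachable (l a b) b c hbc hle ?_
  have h₁ : ((levelGraph l hl.symm (l a b)).deleteEdges {s(b, c)}).Adj b a := by
    simp [levelGraph, hab.symm, hac, hl.symm b a, hbc]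
  have h₂ : ((levelGraph l hl.symm (l a b)).deleteEdges {s(b, c)}).Adj a c := by
    simp [levelGraph, hab, hac, h]
  exact h₁.reachable.trans h₂.reachable

/-- An edge with the largest label in a set of vertices has all other vertices of the set among its
conditioning vertices. -/
theorem subset_pclique (hl : IsMATLabeling l) {S : Set V} {a b : V} (ha : a ∈ S)
    (hb : b ∈ S) (hab : a ≠ b) (hmax : ∀ c ∈ S, ∀ d ∈ S, l c d ≤ l a b) : S ⊆ pclique l a b := by
  intro c hc
  by_cases hca : c = a
  · exact hca ▸ left_mem_pclique _ _
  by_cases hcb : c = b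
  · exact hcb ▸ right_mem_pclique _ _
  refine condSet_subset_pclique _ _ ⟨lt_of_le_of_ne (hmax a ha c hc) fun h => ?_,
    lt_of_le_of_ne (hmax c hc b hb) fun h => ?_⟩
  · have := hl.lt_of_eq (Ne.symm hca) hab hcb h
    have := hmax c hc b hb
    omega
  · have := hl.lt_of_eq (Ne.symm hcb) hab.symm hca (by rw [hl.symm b c, hl.symm b a, h])
    have := hmax c hc a ha
    have := hl.symm c b
    omega

/-- A set with at least two vertices contains an edge whose label is maximal in the set. -/
theorem exists_max_edge [Finite V] (hl : IsMATLabeling l) {S : Set V} (hS : 2 ≤ S.ncard) :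
    ∃ a ∈ S, ∃ b ∈ S, a ≠ b ∧ ∀ c ∈ S, ∀ d ∈ S, l c d ≤ l a b := by
  obtain ⟨x, hx, y, hy, hxy⟩ := (Set.one_lt_ncard (Set.toFinite S)).1 hS
  obtain ⟨⟨a, b⟩, hab, hmax⟩ := Set.exists_max_image (S ×ˢ S) (fun p => l p.1 p.2)
    (Set.toFinite _) ⟨(x, y), hx, hy⟩
  refine ⟨a, hab.1, b, hab.2, ?_, fun c hc d hd => hmax (c, d) ⟨hc, hd⟩⟩
  rintro rfl
  have h₁ : l x y ≤ l a a := hmax (x, y) ⟨hx, hy⟩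
  have := hl.pos x y hxy
  rw [hl.self a] at h₁
  omega

/-- A set of `k + 1 ≥ 2` vertices with labels at most `k` is the principal clique of some edge of
label `k`. -/
theorem exists_eq_pclique [Finite V] (hl : IsMATLabeling l) {S : Set V} {k : ℕ} (hk : 0 < k)
    (hS : S.ncard = k + 1) (hle : ∀ c ∈ S, ∀ d ∈ S, l c d ≤ k) :
    ∃ a ∈ S, ∃ b ∈ S, a ≠ b ∧ l a b = k ∧ S = pclique l a b := by
  obtain ⟨a, ha, b, hb, hab, hmax⟩ := hl.exists_max_edge (S := S) (by omega)
  have hsub := hl.subset_pclique ha hb hab hmax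
  have hcard := Set.ncard_le_ncard hsub (Set.toFinite _)
  rw [hl.ncard_pclique hab] at hcard
  have := hle a ha b hb
  refine ⟨a, ha, b, hb, hab, by omega, Set.eq_of_subset_of_ncard_le hsub ?_ (Set.toFinite _)⟩
  rw [hl.ncard_pclique hab]
  omega

/-- Every edge of label `k` in a set of `k + 1` vertices with labels at most `k` generates the
set. -/
theorem eq_pclique_of_ncard [Finite V] (hl : IsMATLabeling l) {S : Set V} {a b : V} (ha : a ∈ S)
    (hb : b ∈ S) (hab : a ≠ b) (hS : S.ncard = l a b + 1)
    (hle : ∀ c ∈ S, ∀ d ∈ S, l c d ≤ l a b) : S = pclique l a b :=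
  Set.eq_of_subset_of_ncard_le (hl.subset_pclique ha hb hab hle)
    (by rw [hl.ncard_pclique hab, hS]) (Set.toFinite _)

/-! ### Chordality of the graphs of bounded labels -/

/-- Chordality of the graph of edges with label `< l a b` makes the conditioning vertices of the
edge `{a, b}` a clique in that graph: two of them form a four-cycle with `a` and `b`. -/
theorem lt_of_chordal (hl : IsMATLabeling l) {a b : V}
    (hab : a ≠ b) (hch : (ltGraph l hl.symm (l a b)).Chordal) {h h' : V} (hh : h ∈ condSet l a b)
    (hh' : h' ∈ condSet l a b) : l h h' < l a b := by
  by_cases hne : h = h'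
  · rw [hne, hl.self]; exact hl.pos a b hab
  have hA : ∀ {x}, x ∈ condSet l a b → (ltGraph l hl.symm (l a b)).Adj a x ∧
      (ltGraph l hl.symm (l a b)).Adj x b := fun {x} hx =>
    ⟨⟨by rintro rfl; exact left_notMem_condSet _ _ hx, hx.1⟩,
      ⟨by rintro rfl; exact right_notMem_condSet _ _ hx, hx.2⟩⟩
  obtain ⟨h₁, h₂⟩ := hA hh
  obtain ⟨h₃, h₄⟩ := hA hh'
  obtain ⟨z, hz, hz₁, hz₂⟩ := hch a h h₁ (.cons h₃ (.cons h₄ (.cons h₂.symm .nil))) (by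
    simp only [Walk.edges_cons, Walk.edges_nil, List.mem_cons, Sym2.eq_iff, List.not_mem_nil]
    have := h₁.ne
    have := h₂.ne
    grind)
  simp only [Walk.support_cons, Walk.support_nil, List.mem_cons, List.not_mem_nil,
    or_false] at hz
  rcases hz with rfl | rfl | rfl | rfl
  · exact absurd rfl hz₁.ne
  · rw [hl.symm]; exact hz₂.2
  · exact absurd hz₁.2 (lt_irrefl _)
  · exact absurd rfl hz₂.ne

/-- A path from `a` to `u` through vertices adjacent to all conditioning vertices of `{u, v}`
consists of edges of label `k = l u v` if the labels between its ends and the conditioning vertices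
are `< k`. Indeed the conditioning vertices form with each edge of the path the principal clique of
a single edge `f` of label `k`. A vertex with a label `k` to some conditioning vertex would be
contained in `f` for both edges of the path at that vertex, so these two edges would agree. -/
theorem levelGraph_reachable_of_path [Finite V] (hl : IsMATLabeling l) {u v : V} (huv : u ≠ v)
    (hch : (ltGraph l hl.symm (l u v)).Chordal) {G : SimpleGraph V}
    (hG : G ≤ ltGraph l hl.symm (l u v + 1)) (hnot : ¬ G.Adj u v)
    {a : V} (p : G.Walk a u) (hp : p.IsPath)
    (hN : ∀ w ∈ p.support, w ∉ condSet l u v ∧ ∀ h ∈ condSet l u v, G.Adj w h)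
    (ha : ∀ h ∈ condSet l u v, l a h < l u v) :
    ((levelGraph l hl.symm (l u v)).deleteEdges {s(u, v)}).Reachable a u := by
  have hpos := hl.pos u v huv
  -- two adjacent vertices of the path form with `condSet l u v` a set with `l u v + 1` elements
  have hcard : ∀ w w' : V, w ∉ condSet l u v → w' ∉ condSet l u v → w ≠ w' →
      (insert w (insert w' (condSet l u v))).ncard = l u v + 1 := by
    intro w w' hw hw' hne
    rw [Set.ncard_insert_of_notMem (by simp [hne, hw]) (Set.toFinite _),
      Set.ncard_insert_of_notMem hw' (Set.toFinite _), hl.ncard_condSet u v huv]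
    omega
  have hle : ∀ w w' : V, (∀ h ∈ condSet l u v, G.Adj w h) → (∀ h ∈ condSet l u v, G.Adj w' h) →
      G.Adj w w' → ∀ c ∈ insert w (insert w' (condSet l u v)),
      ∀ d ∈ insert w (insert w' (condSet l u v)), l c d ≤ l u v := by
    intro w w' hw hw' hww'
    have h₁ : ∀ h ∈ condSet l u v, l w h ≤ l u v := fun h hh => Nat.lt_succ_iff.1 (hG (hw h hh)).2
    have h₂ : ∀ h ∈ condSet l u v, l w' h ≤ l u v :=
      fun h hh => Nat.lt_succ_iff.1 (hG (hw' h hh)).2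
    have h₃ : l w w' ≤ l u v := Nat.lt_succ_iff.1 (hG hww').2
    rintro c (rfl | rfl | hc) d (rfl | rfl | hd)
    · rw [hl.self]; exact hpos.le
    · exact h₃
    · exact h₁ d hd
    · rw [hl.symm]; exact h₃
    · rw [hl.self]; exact hpos.le
    · exact h₂ d hd
    · rw [hl.symm]; exact h₁ c hc
    · rw [hl.symm]; exact h₂ c hc
    · exact (hl.lt_of_chordal huv hch hc hd).le
  induction p with
  | nil => exact .refl _
  | @cons a w u h p ih =>
    rw [Walk.cons_isPath_iff] at hp
    simp only [Walk.support_cons, List.mem_cons, forall_eq_or_imp] at hN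
    have hNw := hN.2 w p.start_mem_support
    by_cases hw : ∀ h ∈ condSet l u v, l w h < l u v
    · refine .trans (Adj.reachable ?_) (ih huv hch hG hnot hp.1 hN.2 hw hpos hcard hle)
      obtain ⟨c, hc, d, hd, -, hcd, -⟩ := hl.exists_eq_pclique hpos
        (hcard a w hN.1.1 hNw.1 h.ne) (hle a w hN.1.2 hNw.2 h)
      have haw : l a w = l u v := by
        rcases hc with rfl | rfl | hc <;> rcases hd with rfl | rfl | hd
        · rw [hl.self] at hcd; omega
        · exact hcd
        · exact absurd hcd (ha d hd).ne
        · rw [hl.symm]; exact hcd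
        · rw [hl.self] at hcd; omega
        · exact absurd hcd (hw d hd).ne
        · exact absurd (hl.symm c d ▸ hcd) (ha c hc).ne
        · exact absurd (hl.symm c d ▸ hcd) (hw c hc).ne
        · exact absurd hcd (hl.lt_of_chordal huv hch hc hd).ne
      rw [deleteEdges_adj]
      refine ⟨⟨h.ne, haw⟩, fun he => hnot ?_⟩
      rcases Sym2.eq_iff.1 (Set.mem_singleton_iff.1 he) with ⟨rfl, rfl⟩ | ⟨rfl, rfl⟩
      · exact h
      · exact h.symm
    · exfalso
      push Not at hw
      obtain ⟨x, hx, hwx⟩ := hw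
      have hwx' : l w x = l u v := le_antisymm (Nat.lt_succ_iff.1 (hG (hNw.2 x hx)).2) hwx
      have hwxne : w ≠ x := fun e => hNw.1 (e ▸ hx)
      cases p with
      | nil => exact absurd hx.1 (by omega)
      | @cons _ w' _ h' p =>
        have hNw' := hN.2 w' (by simp)
        have e₁ := hl.eq_pclique_of_ncard (S := insert a (insert w (condSet l u v)))
          (a := w) (b := x) (by simp) (by simp [hx]) hwxne
          (by rw [hwx']; exact hcard a w hN.1.1 hNw.1 h.ne)
          (by rw [hwx']; exact hle a w hN.1.2 hNw.2 h)
        have e₂ := hl.eq_pclique_of_ncard (S := insert w (insert w' (condSet l u v)))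
          (a := w) (b := x) (by simp) (by simp [hx]) hwxne
          (by rw [hwx']; exact hcard w w' hNw.1 hNw'.1 h'.ne)
          (by rw [hwx']; exact hle w w' hNw.2 hNw'.2 h')
        have hmem : a ∈ insert w (insert w' (condSet l u v)) := by
          rw [e₂, ← e₁]; exact Set.mem_insert _ _
        rcases hmem with rfl | rfl | hmem
        · exact h.ne rfl
        · exact hp.2 (by simp)
        · exact hN.1.1 hmem

/-- In a chordal graph between those of the labels `< k` and `≤ k`, the common neighbours of the
ends of a missing edge of label `k` separate these ends. -/
theorem exists_common_nbr_of_walk [Finite V] (hl : IsMATLabeling l) {u v : V} (huv : u ≠ v)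
    (hch : (ltGraph l hl.symm (l u v)).Chordal) {G : SimpleGraph V} (hGch : G.Chordal)
    (hG₀ : ltGraph l hl.symm (l u v) ≤ G) (hG : G ≤ ltGraph l hl.symm (l u v + 1))
    (hnot : ¬ G.Adj u v) (p : G.Walk v u) : ∃ z ∈ p.support, G.Adj u z ∧ G.Adj z v := by
  classical
  have hadj : ∀ h ∈ condSet l u v, G.Adj u h ∧ G.Adj h v := fun h hh =>
    ⟨hG₀ ⟨by rintro rfl; exact left_notMem_condSet _ _ hh, hh.1⟩,
      hG₀ ⟨by rintro rfl; exact right_notMem_condSet _ _ hh, hh.2⟩⟩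
  by_contra! hno
  have hS : ∀ h ∈ (Set.toFinite (condSet l u v)).toFinset, h ∈ condSet l u v := by simp
  obtain ⟨q, hq⟩ := hGch.exists_walk_in_common_nbhd (Set.toFinite (condSet l u v)).toFinset
    (fun h hh => (hadj h (hS h hh)).1) (fun h hh => (hadj h (hS h hh)).2.symm) p
    (fun h hh hp => hno h hp (hadj h (hS h hh)).1 (hadj h (hS h hh)).2)
  refine hl.not_reachable (l u v) u v huv le_rfl (Reachable.symm ?_)
  refine hl.levelGraph_reachable_of_path huv hch hG hnot q.bypass q.bypass_isPath ?_ ?_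
  · intro w hw
    have hw' := hq w (q.support_bypass_subset_support hw)
    refine ⟨fun h => ?_, fun h hh => hw'.2 h (by simpa using hh)⟩
    exact hno w hw'.1 (hadj w h).1 (hadj w h).2
  · intro h hh
    rw [hl.symm]
    exact hh.2

/-- Chordality of the graph of edges with label `< k`, and of the intermediate graphs obtained on
adding edges of label `k` one at a time. -/
theorem chordal [Finite V] (hl : IsMATLabeling l) (k : ℕ) : (ltGraph l hl.symm k).Chordal := by
  induction k with
  | zero => exact fun x y h => absurd h.2 (Nat.not_lt_zero _)
  | succ k ih =>
    suffices H : ∀ G : SimpleGraph V, ltGraph l hl.symm k ≤ G → G ≤ ltGraph l hl.symm (k + 1) →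
        G.Chordal from H _ (fun a b h => ⟨h.1, h.2.trans (Nat.lt_succ_self k)⟩) le_rfl
    intro G
    induction G using WellFoundedLT.induction with
    | ind G ihG =>
      intro h₀ h₁
      by_cases heq : ltGraph l hl.symm k = G
      · exact heq ▸ ih
      obtain ⟨u, v, hG, hlt⟩ : ∃ u v, G.Adj u v ∧ ¬ (ltGraph l hl.symm k).Adj u v := by
        by_contra! hno
        exact heq (le_antisymm h₀ fun a b h => hno a b h)
      have hk : l u v = k := by
        have h₂ : l u v < k + 1 := (h₁ hG).2
        have h₃ : ¬ l u v < k := fun h => hlt ⟨hG.ne, h⟩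
        omega
      subst hk
      have hnot : ¬ (G.deleteEdges {s(u, v)}).Adj u v := by simp
      have hGeq : G = G.deleteEdges {s(u, v)} ⊔ edge u v := by
        ext a b
        simp only [sup_adj, deleteEdges_adj, edge_adj, Set.mem_singleton_iff, Sym2.eq_iff]
        constructor
        · intro h
          have := h.ne
          tauto
        · rintro (h | ⟨⟨rfl, rfl⟩ | ⟨rfl, rfl⟩, -⟩)
          · exact h.1
          · exact hG
          · exact hG.symm
      have hlt' : G.deleteEdges {s(u, v)} < G :=
        lt_of_le_of_ne (deleteEdges_le _) fun h => hnot (h.symm ▸ hG)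
      have hle₀ : ltGraph l hl.symm (l u v) ≤ G.deleteEdges {s(u, v)} := by
        intro a b h
        rw [deleteEdges_adj]
        refine ⟨h₀ h, fun he => ?_⟩
        rcases Sym2.eq_iff.1 (Set.mem_singleton_iff.1 he) with ⟨rfl, rfl⟩ | ⟨rfl, rfl⟩
        · exact hlt h
        · exact hlt h.symm
      have hle₁ := hlt'.le.trans h₁
      have hch := ihG _ hlt' hle₀ hle₁
      rw [hGeq]
      refine hch.sup_edge hG.ne fun p => ?_
      obtain ⟨z, hz, hz'⟩ := hl.exists_common_nbr_of_walk hG.ne ih hch hle₀ hle₁ hnot p.reverse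
      exact ⟨z, by simpa using hz, hz'⟩

/-- Two conditioning vertices of an edge form an edge of smaller label. -/
theorem lt_of_mem_condSet [Finite V] (hl : IsMATLabeling l) {a b : V} (hab : a ≠ b) {h h' : V}
    (hh : h ∈ condSet l a b) (hh' : h' ∈ condSet l a b) : l h h' < l a b :=
  hl.lt_of_chordal hab (hl.chordal _) hh hh'

end IsMATLabeling

end Labeling

/-! ### Closed sets of vertices -/

section ClosedSets

variable {V : Type*}

/-- A set of vertices is closed if it contains the conditioning vertices of each of its edges. -/
def IsClosedSet (l : V → V → ℕ) (S : Set V) : Prop :=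
  ∀ a ∈ S, ∀ b ∈ S, a ≠ b → condSet l a b ⊆ S

variable {l : V → V → ℕ}

theorem IsClosedSet.inter {S T : Set V} (hS : IsClosedSet l S) (hT : IsClosedSet l T) :
    IsClosedSet l (S ∩ T) := fun a ha b hb hab =>
  Set.subset_inter (hS a ha.1 b hb.1 hab) (hT a ha.2 b hb.2 hab)

theorem isClosedSet_univ : IsClosedSet l (Set.univ : Set V) := fun _ _ _ _ _ => Set.subset_univ _

theorem isClosedSet_of_subsingleton {S : Set V} (hS : S.Subsingleton) : IsClosedSet l S :=
  fun _ ha _ hb hab => absurd (hS ha hb) hab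

theorem IsClosedSet.pclique_subset {S : Set V} (hS : IsClosedSet l S) {a b : V} (ha : a ∈ S)
    (hb : b ∈ S) (hab : a ≠ b) : pclique l a b ⊆ S :=
  Set.union_subset (Set.pair_subset ha hb) (hS a ha b hb hab)

namespace IsMATLabeling

variable [Finite V]

theorem lt_of_mem_pclique_diff (hl : IsMATLabeling l) {a b : V} (hab : a ≠ b) {c d : V}
    (hc : c ∈ pclique l a b \ {a}) (hd : d ∈ pclique l a b \ {a}) : l c d < l a b := by
  have hpos := hl.pos a b hab
  obtain ⟨(rfl | rfl) | hc, hca⟩ := hc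
  · exact absurd rfl hca
  · obtain ⟨(rfl | rfl) | hd, hda⟩ := hd
    · exact absurd rfl hda
    · rwa [hl.self]
    · rw [hl.symm]; exact hd.2
  · obtain ⟨(rfl | rfl) | hd, hda⟩ := hd
    · exact absurd rfl hda
    · exact hc.2
    · exact hl.lt_of_mem_condSet hab hc hd

theorem ncard_pclique_diff (hl : IsMATLabeling l) {a b : V} (hab : a ≠ b) :
    (pclique l a b \ {a}).ncard = l a b := by
  rw [Set.ncard_sdiff_singleton_of_mem (left_mem_pclique a b), hl.ncard_pclique hab]
  rfl

/-- Principal cliques are closed: without one end of the generating edge of label `k`, such a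
clique is a principal clique of an edge of label `k - 1`. -/
theorem isClosedSet_pclique_and_diff (hl : IsMATLabeling l) {a b : V} (hab : a ≠ b) :
    IsClosedSet l (pclique l a b) ∧ IsClosedSet l (pclique l a b \ {a}) ∧
      IsClosedSet l (pclique l a b \ {b}) := by
  obtain ⟨k, hk⟩ : ∃ k, l a b = k := ⟨_, rfl⟩
  induction k using Nat.strong_induction_on generalizing a b with
  | _ k ih =>
    have aux : ∀ {a b : V}, a ≠ b → l a b = k → IsClosedSet l (pclique l a b \ {a}) := by
      intro a b hab hk
      have hcard := hl.ncard_pclique_diff hab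
      have hpos := hl.pos a b hab
      by_cases h1 : l a b = 1
      · exact isClosedSet_of_subsingleton
          (Set.ncard_le_one_iff_subsingleton.1 (by rw [hcard, h1]))
      · obtain ⟨c, -, d, -, hcd, hlcd, heq⟩ := hl.exists_eq_pclique (S := pclique l a b \ {a})
          (k := l a b - 1) (by omega) (by omega)
          fun c hc d hd => Nat.le_sub_one_of_lt (hl.lt_of_mem_pclique_diff hab hc hd)
        rw [heq]
        exact (ih (l c d) (by omega) hcd rfl).1
    have ha := aux hab hk
    have hb : IsClosedSet l (pclique l a b \ {b}) := by
      rw [hl.pclique_symm]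
      exact aux hab.symm (by rw [hl.symm, hk])
    refine ⟨fun c hc d hd hcd => ?_, ha, hb⟩
    by_cases h₁ : c ≠ a ∧ d ≠ a
    · exact (ha c ⟨hc, h₁.1⟩ d ⟨hd, h₁.2⟩ hcd).trans Set.sdiff_subset
    by_cases h₂ : c ≠ b ∧ d ≠ b
    · exact (hb c ⟨hc, h₂.1⟩ d ⟨hd, h₂.2⟩ hcd).trans Set.sdiff_subset
    have h₃ : (c = a ∧ d = b) ∨ (c = b ∧ d = a) := by grind
    rcases h₃ with ⟨rfl, rfl⟩ | ⟨rfl, rfl⟩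
    · exact condSet_subset_pclique _ _
    · rw [hl.condSet_symm]; exact condSet_subset_pclique _ _

/-- A closed set with at least two elements is the principal clique of its edge of largest
label. -/
theorem exists_eq_pclique_of_isClosedSet (hl : IsMATLabeling l) {S : Set V}
    (hS : IsClosedSet l S) (h2 : 2 ≤ S.ncard) : ∃ a b, a ≠ b ∧ S = pclique l a b := by
  obtain ⟨a, ha, b, hb, hab, hmax⟩ := hl.exists_max_edge h2
  exact ⟨a, b, hab, Set.Subset.antisymm (hl.subset_pclique ha hb hab hmax)
    (hS.pclique_subset ha hb hab)⟩

/-- The nonempty closed sets are the singletons and the principal cliques. -/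
theorem isClosedSet_and_nonempty_iff (hl : IsMATLabeling l) {S : Set V} :
    IsClosedSet l S ∧ S.Nonempty ↔ (∃ a, S = {a}) ∨ ∃ a b, a ≠ b ∧ S = pclique l a b := by
  constructor
  · rintro ⟨hS, hne⟩
    have hpos := (Set.ncard_pos (Set.toFinite S)).2 hne
    by_cases h1 : S.ncard = 1
    · exact Or.inl (Set.ncard_eq_one.1 h1)
    · exact Or.inr (hl.exists_eq_pclique_of_isClosedSet hS (by omega))
  · rintro (⟨a, rfl⟩ | ⟨a, b, hab, rfl⟩)
    · exact ⟨isClosedSet_of_subsingleton Set.subsingleton_singleton, Set.singleton_nonempty a⟩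
    · exact ⟨(hl.isClosedSet_pclique_and_diff hab).1, a, left_mem_pclique a b⟩

/-- Each closed set with at least two elements has two maximal closed proper subsets, obtained by
removing one of the ends of its generating edge. -/
theorem exists_diff_of_isClosedSet (hl : IsMATLabeling l) {S : Set V}
    (hS : IsClosedSet l S) (h2 : 2 ≤ S.ncard) : ∃ a ∈ S, ∃ b ∈ S, a ≠ b ∧
      IsClosedSet l (S \ {a}) ∧ IsClosedSet l (S \ {b}) ∧
      ∀ T, IsClosedSet l T → T ⊆ S → T ≠ S → T ⊆ S \ {a} ∨ T ⊆ S \ {b} := by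
  obtain ⟨a, b, hab, rfl⟩ := hl.exists_eq_pclique_of_isClosedSet hS h2
  obtain ⟨-, ha, hb⟩ := hl.isClosedSet_pclique_and_diff hab
  refine ⟨a, left_mem_pclique a b, b, right_mem_pclique a b, hab, ha, hb, fun T hT hTS hne => ?_⟩
  by_contra! hno
  have haT : a ∈ T := by_contra fun h => hno.1 (Set.subset_sdiff_singleton hTS h)
  have hbT : b ∈ T := by_contra fun h => hno.2 (Set.subset_sdiff_singleton hTS h)
  exact hne (Set.Subset.antisymm hTS (hT.pclique_subset haT hbT hab))

theorem exists_isClosedSet_subset (hl : IsMATLabeling l) {S : Set V}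
    (hS : IsClosedSet l S) {r : ℕ} (hr : r ≤ S.ncard) :
    ∃ T ⊆ S, IsClosedSet l T ∧ T.ncard = r := by
  obtain ⟨n, hn⟩ : ∃ n, S.ncard = n := ⟨_, rfl⟩
  induction n generalizing S with
  | zero => exact ⟨S, subset_rfl, hS, by omega⟩
  | succ n ih =>
    by_cases hrn : r = n + 1
    · exact ⟨S, subset_rfl, hS, by omega⟩
    by_cases h2 : 2 ≤ S.ncard
    · obtain ⟨a, ha, -, -, -, hSa, -⟩ := hl.exists_diff_of_isClosedSet hS h2
      have hc := Set.ncard_sdiff_singleton_of_mem ha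
      obtain ⟨T, hT, hT'⟩ := ih hSa (by omega) (by omega)
      exact ⟨T, hT.trans Set.sdiff_subset, hT'⟩
    · refine ⟨∅, Set.empty_subset _, isClosedSet_of_subsingleton Set.subsingleton_empty, ?_⟩
      rw [Set.ncard_empty]
      omega

/-- The number of closed subsets with `r` elements of a closed set with `m` elements is
`m + 1 - r`: by inclusion and exclusion, the number for `m` is twice the number for `m - 1` minus
the number for `m - 2`. -/
theorem ncard_isClosedSet (hl : IsMATLabeling l) {S : Set V} (hS : IsClosedSet l S) {r : ℕ}
    (hr : 1 ≤ r) : {T : Set V | IsClosedSet l T ∧ T ⊆ S ∧ T.ncard = r}.ncard = S.ncard + 1 - r := by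
  obtain ⟨n, hn⟩ : ∃ n, S.ncard = n := ⟨_, rfl⟩
  induction n using Nat.strong_induction_on generalizing S with
  | _ n ih =>
    rcases lt_trichotomy r S.ncard with hlt | heq | hgt
    · obtain ⟨a, ha, b, hb, hab, hSa, hSb, hmax⟩ :=
        hl.exists_diff_of_isClosedSet hS (by omega)
      have hca := Set.ncard_sdiff_singleton_of_mem ha
      have hcb := Set.ncard_sdiff_singleton_of_mem hb
      have hcab : (S \ {a} ∩ (S \ {b})).ncard = S.ncard - 2 := by
        have : S \ {a} ∩ (S \ {b}) = (S \ {a}) \ {b} := by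
          ext x; simp only [Set.mem_inter_iff, Set.mem_sdiff, Set.mem_singleton_iff]; tauto
        rw [this, Set.ncard_sdiff_singleton_of_mem (show b ∈ S \ {a} from ⟨hb, hab.symm⟩), hca]
        rfl
      have e₁ := ih (S \ {a}).ncard (by omega) hSa rfl
      have e₂ := ih (S \ {b}).ncard (by omega) hSb rfl
      have e₃ := ih (S \ {a} ∩ (S \ {b})).ncard (by omega) (hSa.inter hSb) rfl
      have hu : {T : Set V | IsClosedSet l T ∧ T ⊆ S ∧ T.ncard = r} =
          {T : Set V | IsClosedSet l T ∧ T ⊆ S \ {a} ∧ T.ncard = r} ∪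
          {T : Set V | IsClosedSet l T ∧ T ⊆ S \ {b} ∧ T.ncard = r} := by
        ext T
        simp only [Set.mem_union, Set.mem_ofPred_eq]
        constructor
        · rintro ⟨h₁, h₂, h₃⟩
          rcases hmax T h₁ h₂ (by rintro rfl; omega) with h | h
          · exact Or.inl ⟨h₁, h, h₃⟩
          · exact Or.inr ⟨h₁, h, h₃⟩
        · rintro (⟨h₁, h₂, h₃⟩ | ⟨h₁, h₂, h₃⟩)
          · exact ⟨h₁, h₂.trans Set.sdiff_subset, h₃⟩
          · exact ⟨h₁, h₂.trans Set.sdiff_subset, h₃⟩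
      have hi : {T : Set V | IsClosedSet l T ∧ T ⊆ S \ {a} ∧ T.ncard = r} ∩
          {T : Set V | IsClosedSet l T ∧ T ⊆ S \ {b} ∧ T.ncard = r} =
          {T : Set V | IsClosedSet l T ∧ T ⊆ S \ {a} ∩ (S \ {b}) ∧ T.ncard = r} := by
        ext T
        simp only [Set.mem_inter_iff, Set.mem_ofPred_eq, Set.subset_inter_iff]
        tauto
      have key := Set.ncard_union_add_ncard_inter
        {T : Set V | IsClosedSet l T ∧ T ⊆ S \ {a} ∧ T.ncard = r}
        {T : Set V | IsClosedSet l T ∧ T ⊆ S \ {b} ∧ T.ncard = r}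
        (Set.toFinite _) (Set.toFinite _)
      rw [← hu, hi, e₁, e₂, e₃, hca, hcb, hcab] at key
      omega
    · have : {T : Set V | IsClosedSet l T ∧ T ⊆ S ∧ T.ncard = r} = {S} := by
        ext T
        simp only [Set.mem_ofPred_eq, Set.mem_singleton_iff]
        constructor
        · rintro ⟨-, h₂, h₃⟩
          exact Set.eq_of_subset_of_ncard_le h₂ (by omega) (Set.toFinite _)
        · rintro rfl
          exact ⟨hS, subset_rfl, heq.symm⟩
      rw [this, Set.ncard_singleton]
      omega
    · have : {T : Set V | IsClosedSet l T ∧ T ⊆ S ∧ T.ncard = r} = ∅ := by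
        ext T
        simp only [Set.mem_ofPred_eq, Set.mem_empty_iff_false, iff_false]
        rintro ⟨-, h₂, h₃⟩
        have := Set.ncard_le_ncard h₂ (Set.toFinite _)
        omega
      rw [this, Set.ncard_empty]
      omega

end IsMATLabeling

end ClosedSets

/-! ### The edges of the associated graphs -/

/-- The edges of the `i`-th associated graph correspond to the elements of rank `i + 1`. -/
theorem card_edgeSet_assocGraph {P : Type u} [PartialOrder P] {rk : P → ℕ}
    (hg : IsRankFunction rk) (h2 : ∀ v : P, ¬ IsMin v → (coveredBy v).ncard = 2)
    (h1 : ∀ a b : P, a ≠ b → rk a = rk b → ∀ v w : P, a ⋖ v → b ⋖ v → a ⋖ w → b ⋖ w → v = w)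
    {i : ℕ} (hi : 1 ≤ i) :
    Nat.card (assocGraph rk i).edgeSet = Nat.card {v : P // rk v = i + 1} := by
  have hex : ∀ e : (assocGraph rk i).edgeSet, ∃ v : {v : P // rk v = i + 1},
      coveredBy v.1 = {x | ∃ y ∈ e.1, y.1 = x} := by
    rintro ⟨e, he⟩
    induction e with
    | h a b =>
      obtain ⟨-, v, hv, hc⟩ := (SimpleGraph.mem_edgeSet _).1 he
      refine ⟨⟨v, hv⟩, hc.trans ?_⟩
      ext x
      simp [eq_comm]
  choose f hf using hex
  refine Nat.card_congr (Equiv.ofBijective f ⟨fun e e' h => ?_, fun v => ?_⟩)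
  · have h' : {x | ∃ y ∈ e.1, y.1 = x} = {x | ∃ y ∈ e'.1, y.1 = x} := by rw [← hf, ← hf, h]
    apply Subtype.ext
    refine Sym2.ext fun y => ?_
    have hmem : ∀ e : Sym2 {x : P // rk x = i}, y ∈ e ↔ y.1 ∈ {x | ∃ y ∈ e, y.1 = x} := fun e =>
      ⟨fun hy => ⟨y, hy, rfl⟩, fun ⟨z, hz, hzy⟩ => Subtype.ext hzy ▸ hz⟩
    rw [hmem, hmem, h']
  · have hnm : ¬ IsMin v.1 := fun h => by
      have := hg.isMin _ h
      have := v.2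
      omega
    obtain ⟨a, b, hab, hcv⟩ := Set.ncard_eq_two.1 (h2 v.1 hnm)
    have ha : a ⋖ v.1 := show a ∈ coveredBy v.1 by rw [hcv]; simp
    have hb : b ⋖ v.1 := show b ∈ coveredBy v.1 by rw [hcv]; simp
    have hra : rk a = i := by have := hg.covBy _ _ ha; have := v.2; omega
    have hrb : rk b = i := by have := hg.covBy _ _ hb; have := v.2; omega
    have hadj : (assocGraph rk i).Adj ⟨a, hra⟩ ⟨b, hrb⟩ :=
      ⟨fun h => hab (congrArg Subtype.val h), v.1, v.2, hcv⟩
    refine ⟨⟨s(⟨a, hra⟩, ⟨b, hrb⟩), hadj⟩, Subtype.ext ?_⟩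
    have hc' := hf ⟨s(⟨a, hra⟩, ⟨b, hrb⟩), hadj⟩
    refine h1 a b hab (hra.trans hrb.symm) _ _ ?_ ?_ ha hb
    · show a ∈ coveredBy _
      rw [hc']; exact ⟨⟨a, hra⟩, by simp, rfl⟩
    · show b ∈ coveredBy _
      rw [hc']; exact ⟨⟨b, hrb⟩, by simp, rfl⟩

/-! ### The poset of nonempty closed sets is a regular vine -/

section Nodes

variable {V : Type u} [Finite V] {l : V → V → ℕ} {p : Set V → Prop}

namespace IsMATLabeling

theorem node_covBy_iff (hl : IsMATLabeling l) (hp : ∀ s, p s ↔ IsClosedSet l s ∧ s.Nonempty)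
    {X Y : {s : Set V // p s}} : X ⋖ Y ↔ X.1 ⊆ Y.1 ∧ X.1.ncard + 1 = Y.1.ncard := by
  have hpos : ∀ Z : {s : Set V // p s}, 0 < Z.1.ncard := fun Z =>
    (Set.ncard_pos (Set.toFinite _)).2 ((hp Z.1).1 Z.2).2
  have hlt : ∀ {Z W : {s : Set V // p s}}, Z < W → Z.1.ncard < W.1.ncard := fun {Z W} h =>
    Set.ncard_lt_ncard (show Z.1 ⊂ W.1 from h) (Set.toFinite _)
  constructor
  · intro h
    have hsub : X.1 ⊆ Y.1 := h.le
    refine ⟨hsub, ?_⟩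
    have hltXY := hlt h.lt
    have := hpos X
    obtain ⟨a, ha, b, hb, hab, hYa, hYb, hmax⟩ :=
      hl.exists_diff_of_isClosedSet ((hp _).1 Y.2).1 (by omega)
    have key : ∀ c ∈ Y.1, IsClosedSet l (Y.1 \ {c}) → X.1 ⊆ Y.1 \ {c} →
        X.1.ncard + 1 = Y.1.ncard := by
      intro c hc hYc hXc
      have hcard := Set.ncard_sdiff_singleton_of_mem hc
      let Z : {s : Set V // p s} :=
        ⟨Y.1 \ {c}, (hp _).2 ⟨hYc, (Set.ncard_pos (Set.toFinite _)).1 (by omega)⟩⟩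
      have hZY : Z < Y := lt_of_le_of_ne Set.sdiff_subset fun h => by
        have : Z.1.ncard = Y.1.ncard := by rw [h]
        simp only [Z] at this
        omega
      have hXZ : X ≤ Z := hXc
      rcases hXZ.lt_or_eq with h' | h'
      · exact absurd hZY (h.2 h')
      · rw [h']
        simp only [Z]
        omega
    rcases hmax X.1 ((hp _).1 X.2).1 hsub (fun e => h.ne (Subtype.ext e)) with h' | h'
    · exact key a ha hYa h'
    · exact key b hb hYb h'
  · rintro ⟨hsub, hcard⟩
    refine ⟨lt_of_le_of_ne hsub fun e => by rw [e] at hcard; omega, fun Z h₁ h₂ => ?_⟩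
    have := hlt h₁
    have := hlt h₂
    omega

/-- The two nodes covered by a node with at least two elements are its maximal closed proper
subsets. -/
theorem exists_coveredBy_node (hl : IsMATLabeling l)
    (hp : ∀ s, p s ↔ IsClosedSet l s ∧ s.Nonempty) (Y : {s : Set V // p s})
    (h2 : 2 ≤ Y.1.ncard) : ∃ a ∈ Y.1, ∃ b ∈ Y.1, a ≠ b ∧ ∃ A B : {s : Set V // p s},
      A.1 = Y.1 \ {a} ∧ B.1 = Y.1 \ {b} ∧ A ≠ B ∧ coveredBy Y = {A, B} ∧
      ∀ T, IsClosedSet l T → T ⊆ Y.1 → T ≠ Y.1 → T ⊆ A.1 ∨ T ⊆ B.1 := by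
  obtain ⟨a, ha, b, hb, hab, hYa, hYb, hmax⟩ :=
    hl.exists_diff_of_isClosedSet ((hp _).1 Y.2).1 h2
  have hca := Set.ncard_sdiff_singleton_of_mem ha
  have hcb := Set.ncard_sdiff_singleton_of_mem hb
  refine ⟨a, ha, b, hb, hab,
    ⟨Y.1 \ {a}, (hp _).2 ⟨hYa, (Set.ncard_pos (Set.toFinite _)).1 (by omega)⟩⟩,
    ⟨Y.1 \ {b}, (hp _).2 ⟨hYb, (Set.ncard_pos (Set.toFinite _)).1 (by omega)⟩⟩, rfl, rfl, ?_, ?_,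
    hmax⟩
  · intro h
    have h' : Y.1 \ {a} = Y.1 \ {b} := congrArg Subtype.val h
    have : a ∈ Y.1 \ {a} := by rw [h']; exact ⟨ha, hab⟩
    exact this.2 rfl
  · ext X
    rw [Set.mem_insert_iff, Set.mem_singleton_iff]
    change X ⋖ Y ↔ _
    rw [hl.node_covBy_iff hp]
    constructor
    · rintro ⟨hsub, hcard⟩
      rcases hmax X.1 ((hp _).1 X.2).1 hsub (fun e => by rw [e] at hcard; omega) with h | h
      · exact Or.inl (Subtype.ext
          (Set.eq_of_subset_of_ncard_le h (by simp only; omega) (Set.toFinite _)))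
      · exact Or.inr (Subtype.ext
          (Set.eq_of_subset_of_ncard_le h (by simp only; omega) (Set.toFinite _)))
    · rintro (rfl | rfl)
      · exact ⟨Set.sdiff_subset, by simp only; omega⟩
      · exact ⟨Set.sdiff_subset, by simp only; omega⟩

theorem node_isMin_iff (hp : ∀ s, p s ↔ IsClosedSet l s ∧ s.Nonempty)
    {X : {s : Set V // p s}} : IsMin X ↔ X.1.ncard = 1 := by
  constructor
  · intro h
    obtain ⟨a, ha⟩ := ((hp _).1 X.2).2
    let A : {s : Set V // p s} := ⟨{a}, (hp _).2
      ⟨isClosedSet_of_subsingleton Set.subsingleton_singleton, Set.singleton_nonempty a⟩⟩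
    have hAX : A ≤ X := Set.singleton_subset_iff.2 ha
    have hXA : X = A := (h.eq_of_le hAX).symm
    rw [hXA]
    exact Set.ncard_singleton a
  · intro h Y hY
    exact (Set.eq_of_subset_of_ncard_le hY
      (by rw [h]; exact (Set.ncard_pos (Set.toFinite _)).2 ((hp _).1 Y.2).2)
      (Set.toFinite _)).ge

theorem card_node (hl : IsMATLabeling l) (hp : ∀ s, p s ↔ IsClosedSet l s ∧ s.Nonempty) {r : ℕ}
    (hr : 1 ≤ r) : Nat.card {X : {s : Set V // p s} // X.1.ncard = r} = Nat.card V + 1 - r := by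
  rw [← Set.ncard_univ V, ← hl.ncard_isClosedSet isClosedSet_univ hr,
    ← Nat.card_coe_set_eq {T : Set V | IsClosedSet l T ∧ T ⊆ Set.univ ∧ T.ncard = r}]
  refine Nat.card_congr ⟨fun X => ⟨X.1.1, ((hp _).1 X.1.2).1, Set.subset_univ _, X.2⟩,
    fun T => ⟨⟨T.1, (hp _).2 ⟨T.2.1, ?_⟩⟩, T.2.2.2⟩, fun X => rfl, fun T => rfl⟩
  exact (Set.ncard_pos (Set.toFinite _)).1 (by have := T.2.2.2; omega)

/-- The nodes with `r` elements contained in a given closed set are connected in the associated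
graph: the two maximal closed proper subsets meet in a closed set. -/
theorem node_reachable (hl : IsMATLabeling l) (hp : ∀ s, p s ↔ IsClosedSet l s ∧ s.Nonempty)
    {r : ℕ} (hr : 1 ≤ r) (S : Set V) (hS : IsClosedSet l S)
    (X Y : {X : {s : Set V // p s} // X.1.ncard = r}) (hX : X.1.1 ⊆ S) (hY : Y.1.1 ⊆ S) :
    (assocGraph (fun s : {s : Set V // p s} => s.1.ncard) r).Reachable X Y := by
  obtain ⟨n, hn⟩ : ∃ n, S.ncard = n := ⟨_, rfl⟩
  induction n generalizing S X Y with
  | zero =>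
    have := Set.ncard_le_ncard hX (Set.toFinite _)
    have := X.2
    omega
  | succ n ih =>
    have hXle := Set.ncard_le_ncard hX (Set.toFinite _)
    have hXr := X.2
    have hYr := Y.2
    have eqS : r = n + 1 → ∀ Z : {X : {s : Set V // p s} // X.1.ncard = r}, Z.1.1 ⊆ S →
        Z.1.1 = S := fun h Z hZ =>
      Set.eq_of_subset_of_ncard_le hZ (by have := Z.2; omega) (Set.toFinite _)
    by_cases hrn : r = n + 1
    · rw [show X = Y from Subtype.ext (Subtype.ext ((eqS hrn X hX).trans (eqS hrn Y hY).symm))]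
    have hpS : p S := (hp _).2 ⟨hS, (Set.ncard_pos (Set.toFinite _)).1 (by omega)⟩
    obtain ⟨a, ha, b, hb, hab, A, B, hA, hB, hAB, hcov, hmax⟩ :=
      hl.exists_coveredBy_node hp ⟨S, hpS⟩ (by simp only; omega)
    simp only at ha hb hA hB hmax
    have hca : A.1.ncard = n := by rw [hA, Set.ncard_sdiff_singleton_of_mem ha]; omega
    have hcb : B.1.ncard = n := by rw [hB, Set.ncard_sdiff_singleton_of_mem hb]; omega
    have hAc := ((hp _).1 A.2).1
    have hBc := ((hp _).1 B.2).1
    have cross : ∀ X Y : {X : {s : Set V // p s} // X.1.ncard = r}, X.1.1 ⊆ A.1 → Y.1.1 ⊆ B.1 →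
        (assocGraph (fun s : {s : Set V // p s} => s.1.ncard) r).Reachable X Y := by
      intro X Y hXA hYB
      have hXr := X.2
      have hYr := Y.2
      by_cases hrn' : r = n
      · have hXA' : X.1 = A := Subtype.ext
          (Set.eq_of_subset_of_ncard_le hXA (by omega) (Set.toFinite _))
        have hYB' : Y.1 = B := Subtype.ext
          (Set.eq_of_subset_of_ncard_le hYB (by omega) (Set.toFinite _))
        refine SimpleGraph.Adj.reachable ⟨fun h => hAB ?_, ⟨S, hpS⟩, ?_, ?_⟩
        · rw [← hXA', ← hYB', h]
        · simp only; omega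
        · rw [hcov, hXA', hYB']
      · have hAB' : (A.1 ∩ B.1).ncard = n - 1 := by
          have : A.1 ∩ B.1 = A.1 \ {b} := by
            ext x
            simp only [hA, hB, Set.mem_inter_iff, Set.mem_sdiff, Set.mem_singleton_iff]
            tauto
          rw [this, Set.ncard_sdiff_singleton_of_mem
            (show b ∈ A.1 by rw [hA]; exact ⟨hb, hab.symm⟩), hca]
        obtain ⟨T, hTsub, hT, hTr⟩ := hl.exists_isClosedSet_subset (hAc.inter hBc) (r := r)
          (by omega)
        have hpT : p T := (hp _).2 ⟨hT, (Set.ncard_pos (Set.toFinite _)).1 (by omega)⟩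
        exact (ih A.1 hAc X ⟨⟨T, hpT⟩, hTr⟩ hXA (hTsub.trans Set.inter_subset_left) hca).trans
          (ih B.1 hBc ⟨⟨T, hpT⟩, hTr⟩ Y (hTsub.trans Set.inter_subset_right) hYB hcb)
    have hsplit : ∀ Z : {X : {s : Set V // p s} // X.1.ncard = r}, Z.1.1 ⊆ S →
        Z.1.1 ⊆ A.1 ∨ Z.1.1 ⊆ B.1 := fun Z hZ =>
      hmax Z.1.1 ((hp _).1 Z.1.2).1 hZ fun e => by have := Z.2; rw [e] at this; omega
    rcases hsplit X hX with hX' | hX' <;> rcases hsplit Y hY with hY' | hY'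
    · exact ih A.1 hAc X Y hX' hY' hca
    · exact cross X Y hX' hY'
    · exact (cross Y X hY' hX').symm
    · exact ih B.1 hBc X Y hX' hY' hcb

theorem posetRank_node (hp : ∀ s, p s ↔ IsClosedSet l s ∧ s.Nonempty) :
    posetRank (fun s : {s : Set V // p s} => s.1.ncard) = Nat.card V := by
  rcases isEmpty_or_nonempty V with hV | hV
  · have : IsEmpty {s : Set V // p s} := ⟨fun s => by
      obtain ⟨x, -⟩ := ((hp _).1 s.2).2
      exact isEmptyElim x⟩
    rw [posetRank, Set.range_eq_empty, csSup_empty, Nat.card_of_isEmpty]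
    rfl
  · refine IsGreatest.csSup_eq ⟨⟨⟨Set.univ, (hp _).2 ⟨isClosedSet_univ, Set.univ_nonempty⟩⟩,
      Set.ncard_univ V⟩, ?_⟩
    rintro _ ⟨s, rfl⟩
    exact Set.ncard_le_card _

theorem posetDim_node (hp : ∀ s, p s ↔ IsClosedSet l s ∧ s.Nonempty) :
    posetDim {s : Set V // p s} = Nat.card V := by
  rw [posetDim, ← Nat.card_coe_set_eq]
  have hsing : ∀ a : V, p {a} := fun a =>
    (hp _).2 ⟨isClosedSet_of_subsingleton Set.subsingleton_singleton, Set.singleton_nonempty a⟩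
  refine (Nat.card_congr (Equiv.ofBijective
    (fun a : V => (⟨⟨{a}, hsing a⟩, (node_isMin_iff hp).2 (Set.ncard_singleton a)⟩ :
      {x : {s : Set V // p s} | IsMin x})) ⟨fun a b h => ?_, fun X => ?_⟩)).symm
  · exact Set.singleton_injective (congrArg (fun X => X.1.1) h)
  · obtain ⟨a, ha⟩ := Set.ncard_eq_one.1 ((node_isMin_iff hp).1 X.2)
    exact ⟨a, Subtype.ext (Subtype.ext ha.symm)⟩

/-- The nonempty closed sets form a regular vine. -/
theorem isRVine_node (hl : IsMATLabeling l) (hp : ∀ s, p s ↔ IsClosedSet l s ∧ s.Nonempty) :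
    IsRVine (fun s : {s : Set V // p s} => s.1.ncard) := by
  have hpos : ∀ X : {s : Set V // p s}, 1 ≤ X.1.ncard := fun X =>
    (Set.ncard_pos (Set.toFinite _)).2 ((hp X.1).1 X.2).2
  have hgr : IsRankFunction (fun s : {s : Set V // p s} => s.1.ncard) :=
    { lt := fun X Y h => Set.ncard_lt_ncard (show X.1 ⊂ Y.1 from h) (Set.toFinite _)
      covBy := fun X Y h => ((hl.node_covBy_iff hp).1 h).2
      isMin := fun X h => (node_isMin_iff hp).1 h }
  have htwo : ∀ Y : {s : Set V // p s}, ¬ IsMin Y → (coveredBy Y).ncard = 2 := by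
    intro Y hY
    rw [node_isMin_iff hp] at hY
    have := hpos Y
    obtain ⟨-, -, -, -, -, A, B, -, -, hAB, hcov, -⟩ := hl.exists_coveredBy_node hp Y (by omega)
    rw [hcov, Set.ncard_pair hAB]
  have honce : ∀ X Y : {s : Set V // p s}, X ≠ Y → X.1.ncard = Y.1.ncard →
      ∀ Z W : {s : Set V // p s}, X ⋖ Z → Y ⋖ Z → X ⋖ W → Y ⋖ W → Z = W := by
    -- an element covering both `X` and `Y` is their union
    have key : ∀ X Y : {s : Set V // p s}, X ≠ Y → X.1.ncard = Y.1.ncard →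
        ∀ Z : {s : Set V // p s}, X ⋖ Z → Y ⋖ Z → X.1 ∪ Y.1 = Z.1 := by
      intro X Y hne hc Z h₁ h₂
      rw [hl.node_covBy_iff hp] at h₁ h₂
      refine Set.eq_of_subset_of_ncard_le (Set.union_subset h₁.1 h₂.1) ?_ (Set.toFinite _)
      rw [← h₁.2]
      refine Set.ncard_lt_ncard (Set.ssubset_iff_subset_ne.2 ⟨Set.subset_union_left, fun e => ?_⟩)
        (Set.toFinite _)
      have hYX : Y.1 ⊆ X.1 := by rw [e]; exact Set.subset_union_right
      exact hne (Subtype.ext (Set.eq_of_subset_of_ncard_le hYX hc.le (Set.toFinite _)).symm)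
    intro X Y hne hc Z W h₁ h₂ h₃ h₄
    exact Subtype.ext ((key X Y hne hc Z h₁ h₂).symm.trans (key X Y hne hc W h₃ h₄))
  have htree : ∀ i, 1 ≤ i → i ≤ posetRank (fun s : {s : Set V // p s} => s.1.ncard) →
      (assocGraph (fun s : {s : Set V // p s} => s.1.ncard) i).IsTree := by
    intro i hi hi'
    rw [posetRank_node hp] at hi'
    rw [SimpleGraph.isTree_iff_connected_and_card]
    refine ⟨?_, ?_⟩
    · obtain ⟨T, -, hT, hTi⟩ := hl.exists_isClosedSet_subset (isClosedSet_univ (l := l)) (r := i)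
        (by rwa [Set.ncard_univ])
      have hne : Nonempty {X : {s : Set V // p s} // X.1.ncard = i} :=
        ⟨⟨⟨T, (hp _).2 ⟨hT, (Set.ncard_pos (Set.toFinite _)).1 (by omega)⟩⟩, hTi⟩⟩
      exact ⟨fun X Y => hl.node_reachable hp hi Set.univ isClosedSet_univ X Y
        (Set.subset_univ _) (Set.subset_univ _)⟩
    · rw [card_edgeSet_assocGraph hgr htwo honce hi, hl.card_node hp hi,
        hl.card_node hp (Nat.le_add_left 1 i)]
      omega
  refine
    { vine :=
        { graded := hgr
          covers_two := htwo
          covered_once := honce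
          forest := fun i h₁ h₂ => (htree i h₁ h₂).isAcyclic }
      rank_eq_dim := by rw [posetRank_node hp, posetDim_node hp]
      tree := htree
      proximity := ?_ }
  rintro i hi X Y hne hX hY ⟨Z, hXZ, hYZ⟩
  have hZ : 2 ≤ Z.1.ncard := by
    have := ((hl.node_covBy_iff hp).1 hXZ).2
    omega
  obtain ⟨a, ha, b, hb, hab, A, B, hA, hB, hAB, hcov, -⟩ := hl.exists_coveredBy_node hp Z hZ
  have hAc := ((hp _).1 A.2).1
  have hBc := ((hp _).1 B.2).1
  have hZi : Z.1.ncard = i + 1 := by rw [← ((hl.node_covBy_iff hp).1 hXZ).2, hX]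
  have hca : A.1.ncard = i := by rw [hA, Set.ncard_sdiff_singleton_of_mem ha]; omega
  have hcb : B.1.ncard = i := by rw [hB, Set.ncard_sdiff_singleton_of_mem hb]; omega
  have hAB' : (A.1 ∩ B.1).ncard = i - 1 := by
    have : A.1 ∩ B.1 = A.1 \ {b} := by
      ext x
      simp only [hA, hB, Set.mem_inter_iff, Set.mem_sdiff, Set.mem_singleton_iff]
      tauto
    rw [this, Set.ncard_sdiff_singleton_of_mem
      (show b ∈ A.1 by rw [hA]; exact ⟨hb, hab.symm⟩), hca]
  have hpW : p (A.1 ∩ B.1) :=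
    (hp _).2 ⟨hAc.inter hBc, (Set.ncard_pos (Set.toFinite _)).1 (by omega)⟩
  have hWA : (⟨A.1 ∩ B.1, hpW⟩ : {s : Set V // p s}) ⋖ A :=
    (hl.node_covBy_iff hp).2 ⟨Set.inter_subset_left, by simp only; omega⟩
  have hWB : (⟨A.1 ∩ B.1, hpW⟩ : {s : Set V // p s}) ⋖ B :=
    (hl.node_covBy_iff hp).2 ⟨Set.inter_subset_right, by simp only; omega⟩
  have hX' : X ∈ coveredBy Z := hXZ
  have hY' : Y ∈ coveredBy Z := hYZ
  rw [hcov] at hX' hY'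
  refine ⟨⟨A.1 ∩ B.1, hpW⟩, ?_⟩
  rcases hX' with rfl | rfl <;> rcases hY' with rfl | rfl
  · exact absurd rfl hne
  · exact ⟨hWA, hWB⟩
  · exact ⟨hWB, hWA⟩
  · exact absurd rfl hne

end IsMATLabeling

end Nodes

/-! ### Labels without monochromatic cycles -/

section Elimination

open SimpleGraph

variable {V : Type*} {l : V → V → ℕ}

/-- In every set of at least two vertices there is a vertex such that each triangle of the set at
this vertex has its largest label at this vertex, attained only once there. -/
def HasEliminationVertices (l : V → V → ℕ) : Prop :=
  ∀ S : Set V, S.Nontrivial → ∃ x ∈ S, ∀ c ∈ S, ∀ d ∈ S, c ≠ x → d ≠ x → c ≠ d →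
    l x c ≠ l x d ∧ (l c d < l x c ∨ l c d < l x d)

/-- A path of edges of label `k` between the ends of an edge of label at most `k` consists of this
edge. Take an elimination vertex for the vertices of the path: it cannot be interior to the path, as
its two edges of the path have equal labels, and if it is an end of the path, then removing it
leaves a shorter counterexample. -/
theorem HasEliminationVertices.mem_edges_of_isPath (hE : HasEliminationVertices l)
    (hsymm : ∀ a b, l a b = l b a) {k : ℕ} {a b : V} (hab : a ≠ b) (hk : l a b ≤ k)
    (p : (levelGraph l hsymm k).Walk a b) (hp : p.IsPath) : s(a, b) ∈ p.edges := by
  classical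
  obtain ⟨n, hn⟩ : ∃ n, p.length = n := ⟨_, rfl⟩
  induction n using Nat.strong_induction_on generalizing a b with
  | _ n ih =>
    -- the case of an elimination vertex at the start of the path
    have hstart : ∀ {a b : V} (p : (levelGraph l hsymm k).Walk a b), a ≠ b → l a b ≤ k →
        p.IsPath → p.length = n → (∀ c ∈ p.support, ∀ d ∈ p.support, c ≠ a → d ≠ a → c ≠ d →
          l a c ≠ l a d ∧ (l c d < l a c ∨ l c d < l a d)) → s(a, b) ∈ p.edges := by
      intro a b p hab hk hp hn hx
      cases p with
      | nil => exact absurd rfl hab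
      | @cons _ c _ h p =>
        by_cases hcb : c = b
        · subst hcb; simp
        rw [Walk.cons_isPath_iff] at hp
        rw [Walk.length_cons] at hn
        obtain ⟨h₁, h₂⟩ := hx c (by simp) b (by simp) h.ne' hab.symm hcb
        have hac : l a c = k := h.2
        have hmem := ih p.length (by omega) hcb (by omega) p hp.1 rfl
        have hadj : l c b = k := (p.adj_of_mem_edges hmem).2
        omega
    obtain ⟨x, hxp, hx⟩ := hE {w | w ∈ p.support}
      ⟨a, p.start_mem_support, b, p.end_mem_support, hab⟩
    by_cases hxa : x = a
    · subst hxa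
      exact hstart p hab hk hp hn hx
    by_cases hxb : x = b
    · subst hxb
      have := hstart p.reverse hab.symm (by rwa [hsymm]) hp.reverse (by simpa using hn)
        (fun c hc d hd => hx c (by simpa using hc) d (by simpa using hd))
      rw [Walk.edges_reverse, List.mem_reverse] at this
      rwa [Sym2.eq_swap]
    exfalso
    obtain ⟨q, r, -, -, hqr⟩ := hp.mem_support_iff_exists_append.1 hxp
    cases r with
    | nil => exact hxb rfl
    | @cons _ d _ h₁ r =>
      obtain ⟨c, h₂, hc⟩ : ∃ c, (levelGraph l hsymm k).Adj x c ∧ c ∈ q.support := by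
        rcases hq : q.reverse with _ | ⟨h₂, q'⟩
        · exact absurd rfl hxa
        · refine ⟨_, h₂, ?_⟩
          have := congrArg Walk.support hq
          rw [Walk.support_reverse] at this
          rw [← List.mem_reverse, this]
          simp
      have hcd : c ≠ d := by
        rintro rfl
        rw [hqr, Walk.isPath_def, Walk.support_append, Walk.support_cons, List.tail_cons] at hp
        exact (List.nodup_append.1 hp).2.2 c hc c r.start_mem_support rfl
      have hcp : c ∈ p.support := by
        rw [hqr, Walk.mem_support_append_iff]; exact Or.inl hc
      have hdp : d ∈ p.support := by
        rw [hqr, Walk.mem_support_append_iff]; exact Or.inr (by simp)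
      exact (hx c hcp d hdp h₂.ne' h₁.ne' hcd).1 (h₂.2.trans h₁.2.symm)

theorem HasEliminationVertices.not_reachable (hE : HasEliminationVertices l)
    (hsymm : ∀ a b, l a b = l b a) {k : ℕ} {a b : V} (hab : a ≠ b) (hk : l a b ≤ k) :
    ¬ ((levelGraph l hsymm k).deleteEdges {s(a, b)}).Reachable a b := by
  classical
  rw [reachable_deleteEdges_iff_exists_walk]
  rintro ⟨p, hp⟩
  exact hp (p.edges_bypass_subset_edges
    (hE.mem_edges_of_isPath hsymm hab hk p.bypass p.bypass_isPath))

end Elimination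

/-! ### The structure of regular vines -/

section RVine

theorem le_posetRank {P : Type u} [Finite P] (rk : P → ℕ) (v : P) : rk v ≤ posetRank rk :=
  le_csSup (Set.toFinite _).bddAbove ⟨v, rfl⟩

variable {P : Type u} [PartialOrder P] {rk : P → ℕ}

/-- The minimal elements below `v`. -/
def minsBelow (v : P) : Set {x : P // IsMin x} := {i | i.1 ≤ v}

theorem minsBelow_mono {v w : P} (h : v ≤ w) : minsBelow v ⊆ minsBelow w := fun _ hi => hi.trans h

theorem minsBelow_of_isMin {v : P} (hv : IsMin v) : minsBelow v = {⟨v, hv⟩} := by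
  ext i
  rw [Set.mem_singleton_iff, Subtype.ext_iff]
  exact ⟨fun h => hv.eq_of_le h, fun h => h.le⟩

theorem IsRankFunction.mono (hg : IsRankFunction rk) {v w : P} (h : v ≤ w) : rk v ≤ rk w := by
  rcases h.lt_or_eq with h | rfl
  · exact (hg.lt _ _ h).le
  · exact le_rfl

theorem pair_subset_minsBelow {i j : {x : P // IsMin x}} {u : P} (hu : IsLUB {i.1, j.1} u) :
    {i, j} ⊆ minsBelow u :=
  Set.pair_subset (a := i) (b := j) (hu.1 (Set.mem_insert _ _))
    (hu.1 (Set.mem_insert_of_mem _ rfl))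

namespace IsRVine

theorem graded (h : IsRVine rk) : IsRankFunction rk := h.vine.graded

theorem exists_covers (h : IsRVine rk) {v : P} (hv : ¬ IsMin v) :
    ∃ x y, x ≠ y ∧ coveredBy v = {x, y} ∧ x ⋖ v ∧ y ⋖ v := by
  obtain ⟨x, y, hxy, hc⟩ := Set.ncard_eq_two.1 (h.vine.covers_two v hv)
  refine ⟨x, y, hxy, hc, ?_, ?_⟩
  · show x ∈ coveredBy v
    rw [hc]; simp
  · show y ∈ coveredBy v
    rw [hc]; simp

theorem joinLabel_symm {l : {x : P // IsMin x} → {x : P // IsMin x} → ℕ}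
    (hl : ∀ i j u, i ≠ j → IsLUB {i.1, j.1} u → l i j = rk u - 1)
    (hex : ∀ i j : {x : P // IsMin x}, ∃ u, IsLUB {i.1, j.1} u) (i j) : l i j = l j i := by
  by_cases hij : i = j
  · rw [hij]
  · obtain ⟨u, hu⟩ := hex i j
    rw [hl i j u hij hu, hl j i u (Ne.symm hij) (by rwa [Set.pair_comm])]

end IsRVine

variable [Finite P]

theorem exists_isMin_le (v : P) : ∃ i, IsMin i ∧ i ≤ v := by
  induction v using WellFoundedLT.induction with
  | ind v ih =>
    by_cases hv : IsMin v
    · exact ⟨v, hv, le_rfl⟩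
    · obtain ⟨w, hw⟩ := not_isMin_iff.1 hv
      obtain ⟨i, hi, hiw⟩ := ih w hw
      exact ⟨i, hi, hiw.trans hw.le⟩

theorem IsRankFunction.one_le (hg : IsRankFunction rk) (v : P) : 1 ≤ rk v := by
  obtain ⟨i, hi, hiv⟩ := exists_isMin_le v
  rw [← hg.isMin i hi]
  exact hg.mono hiv

theorem IsRankFunction.isMin_iff (hg : IsRankFunction rk) {v : P} : IsMin v ↔ rk v = 1 := by
  refine ⟨hg.isMin v, fun h => ?_⟩
  by_contra hv
  obtain ⟨w, hw⟩ := not_isMin_iff.1 hv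
  have := hg.lt _ _ hw
  have := hg.one_le w
  omega

namespace IsRVine

theorem le_or_le_of_lt {v x y : P} (hc : coveredBy v = {x, y}) {w : P} (hw : w < v) :
    w ≤ x ∨ w ≤ y := by
  obtain ⟨z, hwz, hz⟩ := hw.exists_le_covby
  have : z ∈ coveredBy v := hz
  rw [hc] at this
  rcases this with rfl | rfl
  · exact Or.inl hwz
  · exact Or.inr hwz

theorem minsBelow_eq_union {v x y : P} (hv : ¬ IsMin v) (hc : coveredBy v = {x, y})
    (hx : x ⋖ v) (hy : y ⋖ v) : minsBelow v = minsBelow x ∪ minsBelow y := by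
  refine Set.Subset.antisymm (fun i hi => ?_)
    (Set.union_subset (minsBelow_mono hx.le) (minsBelow_mono hy.le))
  exact le_or_le_of_lt hc (lt_of_le_of_ne hi fun e => hv (e ▸ i.2))

/-- An element has at most one minimal element below it that is not below a given element it
covers, as the two elements it covers have a common lower cover. -/
theorem subsingleton_minsBelow_diff (h : IsRVine rk) {v x : P} (hx : x ⋖ v) :
    (minsBelow v \ minsBelow x).Subsingleton := by
  obtain ⟨n, hn⟩ : ∃ n, rk v = n := ⟨_, rfl⟩
  induction n using Nat.strong_induction_on generalizing v x with
  | _ n ih =>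
    have hv : ¬ IsMin v := fun hm => hx.lt.not_ge (hm hx.le)
    obtain ⟨y, z, hyz, hc, hy, hz⟩ := h.exists_covers hv
    obtain ⟨y, hxy, hc, hy⟩ : ∃ y, x ≠ y ∧ coveredBy v = {x, y} ∧ y ⋖ v := by
      have : x ∈ coveredBy v := hx
      rw [hc] at this
      rcases this with rfl | rfl
      · exact ⟨z, hyz, hc, hz⟩
      · exact ⟨y, hyz.symm, by rw [hc, Set.pair_comm], hy⟩
    have hrx := h.graded.covBy _ _ hx
    have hry := h.graded.covBy _ _ hy
    have hsub : minsBelow v \ minsBelow x ⊆ minsBelow y \ minsBelow x := by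
      rw [minsBelow_eq_union hv hc hx hy]
      rintro i ⟨h₁ | h₁, h₂⟩
      · exact absurd h₁ h₂
      · exact ⟨h₁, h₂⟩
    by_cases h2 : 2 ≤ rk x
    · obtain ⟨w, hwx, hwy⟩ := h.proximity (rk x) h2 x y hxy rfl (by omega) ⟨v, hx, hy⟩
      refine (ih (rk y) (by omega) hwy rfl).anti (hsub.trans ?_)
      exact Set.sdiff_subset_sdiff_right (minsBelow_mono hwx.le)
    · have hym : IsMin y := h.graded.isMin_iff.2 (by have := h.graded.one_le x; omega)
      refine Set.Subsingleton.anti ?_ (hsub.trans Set.sdiff_subset)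
      rw [minsBelow_of_isMin hym]
      exact Set.subsingleton_singleton

theorem exists_rk_eq (h : IsRVine rk) {v : P} {i : ℕ} (hi : 1 ≤ i) (hiv : i ≤ rk v) :
    ∃ w, rk w = i := by
  induction v using WellFoundedLT.induction with
  | ind v ih =>
    by_cases heq : rk v = i
    · exact ⟨v, heq⟩
    have hv : ¬ IsMin v := fun hm => by have := h.graded.isMin v hm; omega
    obtain ⟨x, -, -, -, hx, -⟩ := h.exists_covers hv
    exact ih x hx.lt (by have := h.graded.covBy _ _ hx; omega)

/-- Elements of rank less than the largest rank `n` are covered by some element: the associated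
graph of their rank `i < n` is connected and has an edge, as there are elements of rank `i + 1`. -/
theorem exists_covBy (h : IsRVine rk) {v : P} (hv : rk v < posetRank rk) : ∃ w, v ⋖ w := by
  have hne : (Set.range rk).Nonempty := ⟨_, v, rfl⟩
  obtain ⟨t, ht⟩ : posetRank rk ∈ Set.range rk := Nat.sSup_mem hne (Set.toFinite _).bddAbove
  obtain ⟨e, he⟩ := h.exists_rk_eq (v := t) (i := rk v + 1) (by omega) (by omega)
  have hem : ¬ IsMin e := fun hm => by
    have := h.graded.isMin e hm
    have := h.graded.one_le v
    omega
  obtain ⟨x, y, hxy, -, hx, hy⟩ := h.exists_covers hem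
  have hrx := h.graded.covBy _ _ hx
  have hry := h.graded.covBy _ _ hy
  have : Nontrivial {x : P // rk x = rk v} :=
    ⟨⟨x, by omega⟩, ⟨y, by omega⟩, fun e => hxy (congrArg Subtype.val e)⟩
  obtain ⟨z, -, w, -, hw⟩ := (h.tree (rk v) (h.graded.one_le v) hv.le).connected.preconnected
    |>.exists_adj_of_nontrivial ⟨v, rfl⟩
  refine ⟨w, ?_⟩
  show v ∈ coveredBy w
  rw [hw]; simp

/-- A nonempty regular vine has a greatest element: the last associated graph is a tree without
edges. -/
theorem exists_top (h : IsRVine rk) [Nonempty P] :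
    ∃ t : P, (∀ v, v ≤ t) ∧ rk t = posetRank rk := by
  obtain ⟨t, ht⟩ : posetRank rk ∈ Set.range rk :=
    Nat.sSup_mem (Set.range_nonempty _) (Set.toFinite _).bddAbove
  refine ⟨t, fun v => ?_, ht⟩
  induction v using WellFoundedGT.induction with
  | ind v ih =>
    rcases (le_posetRank rk v).lt_or_eq with hv | hv
    · obtain ⟨w, hw⟩ := h.exists_covBy hv
      exact hw.le.trans (ih w hw.lt)
    · by_contra hvt
      have : Nontrivial {x : P // rk x = posetRank rk} :=
        ⟨⟨v, hv⟩, ⟨t, ht⟩, fun e => hvt (congrArg Subtype.val e).le⟩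
      obtain ⟨z, -, w, hw, -⟩ := (h.tree (posetRank rk) (hv ▸ h.graded.one_le v) le_rfl).connected
        |>.preconnected.exists_adj_of_nontrivial ⟨v, hv⟩
      have := le_posetRank rk w
      omega

/-- An element of rank `r` has exactly `r` minimal elements below it. Along a maximal chain this
number increases by at most one in each step, and its value at the greatest element, the dimension,
agrees with the rank. -/
theorem ncard_minsBelow (h : IsRVine rk) (v : P) : (minsBelow v).ncard = rk v := by
  have hstep : ∀ {x v : P}, x ⋖ v → (minsBelow v).ncard ≤ (minsBelow x).ncard + 1 := by
    intro x v hx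
    have h₁ := Set.ncard_le_one_iff_subsingleton.2 (h.subsingleton_minsBelow_diff hx)
    have h₂ := Set.ncard_sdiff_add_ncard_of_subset (minsBelow_mono hx.le) (Set.toFinite _)
    omega
  have hne : Nonempty P := ⟨v⟩
  obtain ⟨t, ht, hrt⟩ := h.exists_top
  refine le_antisymm ?_ ?_
  · induction v using WellFoundedLT.induction with
    | ind v ih =>
      by_cases hv : IsMin v
      · rw [minsBelow_of_isMin hv, Set.ncard_singleton]
        exact h.graded.one_le v
      · obtain ⟨x, -, -, -, hx, -⟩ := h.exists_covers hv
        have := ih x hx.lt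
        have := h.graded.covBy _ _ hx
        have := hstep hx
        omega
  · induction v using WellFoundedGT.induction with
    | ind v ih =>
      rcases (ht v).lt_or_eq with hv | rfl
      · obtain ⟨w, hw, -⟩ := exists_covBy_le_of_lt hv
        have := ih w hw.lt
        have := h.graded.covBy _ _ hw
        have := hstep hw
        omega
      · have : minsBelow v = Set.univ := Set.eq_univ_of_forall fun i => ht i.1
        rw [this, Set.ncard_univ, hrt, h.rank_eq_dim, posetDim, ← Nat.card_coe_set_eq]
        rfl

/-- A non-minimal element `v` covers two elements `x` and `y`, and there is one minimal element `i`
below `x` only and one minimal element `j` below `y` only. -/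
theorem exists_covers_and_mins (h : IsRVine rk) {v : P} (hv : ¬ IsMin v) :
    ∃ (x y : P) (i j : {x : P // IsMin x}), coveredBy v = {x, y} ∧ x ⋖ v ∧ y ⋖ v ∧ x ≠ y ∧
      i ≠ j ∧ minsBelow v \ minsBelow x = {j} ∧ minsBelow v \ minsBelow y = {i} := by
  obtain ⟨x, y, hxy, hc, hx, hy⟩ := h.exists_covers hv
  have key : ∀ {x}, x ⋖ v → ∃ j, minsBelow v \ minsBelow x = {j} := by
    intro x hx
    rw [← Set.ncard_eq_one]
    have h₂ := Set.ncard_sdiff_add_ncard_of_subset (minsBelow_mono hx.le) (Set.toFinite _)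
    rw [h.ncard_minsBelow, h.ncard_minsBelow, ← h.graded.covBy _ _ hx] at h₂
    omega
  obtain ⟨j, hj⟩ := key hx
  obtain ⟨i, hi⟩ := key hy
  refine ⟨x, y, i, j, hc, hx, hy, hxy, ?_, hj, hi⟩
  rintro rfl
  have h₁ : i ∈ minsBelow v \ minsBelow x := hj ▸ rfl
  have h₂ : i ∈ minsBelow v \ minsBelow y := hi ▸ rfl
  have h₃ := h₁.1
  rw [minsBelow_eq_union hv hc hx hy] at h₃
  exact h₃.elim h₁.2 h₂.2

/-- The common minimal elements of two elements covered by the same element of rank at least three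
are below a common element. -/
theorem exists_le_of_mem_inter (h : IsRVine rk) {v x y : P} (hc : coveredBy v = {x, y})
    (hx : x ⋖ v) (hy : y ⋖ v) (hxy : x ≠ y) (h2 : 2 ≤ rk x) :
    ∃ w, w ⋖ x ∧ w ⋖ y ∧ minsBelow x ∩ minsBelow y ⊆ minsBelow w := by
  have hrx := h.graded.covBy _ _ hx
  have hry := h.graded.covBy _ _ hy
  have hv : ¬ IsMin v := fun hm => hx.lt.not_ge (hm hx.le)
  obtain ⟨w, hwx, hwy⟩ := h.proximity (rk x) h2 x y hxy rfl (by omega) ⟨v, hx, hy⟩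
  have hrw := h.graded.covBy _ _ hwx
  refine ⟨w, hwx, hwy, ?_⟩
  have hsub : minsBelow w ⊆ minsBelow x ∩ minsBelow y :=
    Set.subset_inter (minsBelow_mono hwx.le) (minsBelow_mono hwy.le)
  refine (Set.eq_of_subset_of_ncard_le hsub ?_ (Set.toFinite _)).ge
  have := Set.ncard_union_add_ncard_inter (minsBelow x) (minsBelow y)
    (Set.toFinite _) (Set.toFinite _)
  rw [← minsBelow_eq_union hv hc hx hy, h.ncard_minsBelow, h.ncard_minsBelow,
    h.ncard_minsBelow] at this
  rw [h.ncard_minsBelow]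
  omega

/-- Among the elements below `v` that are above two given minimal elements there is a least one. -/
theorem exists_least (h : IsRVine rk) (v i j : P) (hi : IsMin i) (hj : IsMin j) (hij : i ≠ j)
    (hiv : i ≤ v) (hjv : j ≤ v) :
    ∃ u ≤ v, i ≤ u ∧ j ≤ u ∧ ∀ w ≤ v, i ≤ w → j ≤ w → u ≤ w := by
  induction v using WellFoundedLT.induction with
  | ind v ih =>
    have hv : ¬ IsMin v := fun hm => hij ((hm.eq_of_le hiv).trans (hm.eq_of_le hjv).symm)
    obtain ⟨x, y, hxy, hc, hx, hy⟩ := h.exists_covers hv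
    have hrx := h.graded.covBy _ _ hx
    have hry := h.graded.covBy _ _ hy
    by_cases hX : i ≤ x ∧ j ≤ x
    · obtain ⟨u, hux, hiu, hju, hu⟩ := ih x hx.lt hX.1 hX.2
      refine ⟨u, hux.trans hx.le, hiu, hju, fun w hw hiw hjw => ?_⟩
      rcases hw.lt_or_eq with hw | rfl
      · rcases le_or_le_of_lt hc hw with hwx | hwy
        · exact hu w hwx hiw hjw
        · -- both `x` and `y` are above `i` and `j`, hence so is some element covered by both
          obtain ⟨u', hu'y, hiu', hju', hu'⟩ := ih y hy.lt (hiw.trans hwy) (hjw.trans hwy)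
          have h2 : 2 ≤ rk x := by
            by_contra h2
            have hxm : IsMin x := h.graded.isMin_iff.2 (by have := h.graded.one_le x; omega)
            exact hij ((hxm.eq_of_le hX.1).trans (hxm.eq_of_le hX.2).symm)
          obtain ⟨z, hzx, hzy, hz⟩ := h.exists_le_of_mem_inter hc hx hy hxy h2
          have hiz : i ≤ z := hz (a := ⟨i, hi⟩) ⟨hX.1, hiw.trans hwy⟩
          have hjz : j ≤ z := hz (a := ⟨j, hj⟩) ⟨hX.2, hjw.trans hwy⟩
          have hu'x : u' ≤ x := (hu' z hzy.le hiz hjz).trans hzx.le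
          exact (hu u' hu'x hiu' hju').trans (hu' w hwy hiw hjw)
      · exact hux.trans hx.le
    by_cases hY : i ≤ y ∧ j ≤ y
    · obtain ⟨u, huy, hiu, hju, hu⟩ := ih y hy.lt hY.1 hY.2
      refine ⟨u, huy.trans hy.le, hiu, hju, fun w hw hiw hjw => ?_⟩
      rcases hw.lt_or_eq with hw | rfl
      · rcases le_or_le_of_lt hc hw with hwx | hwy
        · exact absurd ⟨hiw.trans hwx, hjw.trans hwx⟩ hX
        · exact hu w hwy hiw hjw
      · exact huy.trans hy.le
    · refine ⟨v, le_rfl, hiv, hjv, fun w hw hiw hjw => ?_⟩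
      rcases hw.lt_or_eq with hw | rfl
      · rcases le_or_le_of_lt hc hw with hwx | hwy
        · exact absurd ⟨hiw.trans hwx, hjw.trans hwx⟩ hX
        · exact absurd ⟨hiw.trans hwy, hjw.trans hwy⟩ hY
      · exact le_rfl

/-- Any two minimal elements of a regular vine have a join. -/
theorem exists_isLUB (h : IsRVine rk) (i j : {x : P // IsMin x}) :
    ∃ u, IsLUB {i.1, j.1} u := by
  by_cases hij : i = j
  · subst hij
    exact ⟨i.1, by simp⟩
  have hne : Nonempty P := ⟨i.1⟩
  obtain ⟨t, ht, -⟩ := h.exists_top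
  obtain ⟨u, -, hiu, hju, hu⟩ := h.exists_least t i.1 j.1 i.2 j.2
    (fun e => hij (Subtype.ext e)) (ht _) (ht _)
  refine ⟨u, ?_, fun w hw => hu w (ht w) (hw (by simp)) (hw (by simp))⟩
  rintro _ (rfl | rfl)
  · exact hiu
  · exact hju

/-- An element that is minimal among the upper bounds of a set `S` of at least two minimal elements
is the join of some pair `i, j` of elements of `S`. The joins of all other pairs of minimal elements
below it are below one of its lower covers. -/
theorem exists_isLUB_of_minimal (h : IsRVine rk) {S : Set {x : P // IsMin x}}
    (hS : S.Nontrivial) {u : P} (hSu : S ⊆ minsBelow u)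
    (hu : ∀ w < u, ¬ S ⊆ minsBelow w) :
    ∃ (x y : P) (i j : {x : P // IsMin x}), x < u ∧ y < u ∧ i ∈ S ∧ j ∈ S ∧ i ≠ j ∧
      IsLUB {i.1, j.1} u ∧ minsBelow u \ minsBelow x = {j} ∧ minsBelow u \ minsBelow y = {i} := by
  have hum : ¬ IsMin u := fun hm => by
    rw [minsBelow_of_isMin hm] at hSu
    exact Set.not_subsingleton_iff.2 hS (Set.subsingleton_singleton.anti hSu)
  obtain ⟨x, y, i, j, hc, hx, hy, hxy, hij, hj, hi⟩ := h.exists_covers_and_mins hum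
  have key : ∀ {x : P} {j}, x < u → minsBelow u \ minsBelow x = {j} → j ∈ S := by
    intro x j hx hj
    obtain ⟨s, hs, hsx⟩ := Set.not_subset.1 (hu x hx)
    have : s ∈ minsBelow u \ minsBelow x := ⟨hSu hs, hsx⟩
    rw [hj] at this
    exact this ▸ hs
  have hi' : i ∈ minsBelow u \ minsBelow y := hi ▸ rfl
  have hj' : j ∈ minsBelow u \ minsBelow x := hj ▸ rfl
  refine ⟨x, y, i, j, hx.lt, hy.lt, key hy.lt hi, key hx.lt hj, hij, ?_, hj, hi⟩
  obtain ⟨w, hw⟩ := h.exists_isLUB i j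
  have hwu : w ≤ u := hw.2 (by rintro _ (rfl | rfl); exacts [hi'.1, hj'.1])
  rcases hwu.lt_or_eq with hlt | rfl
  · have hiw : i.1 ≤ w := hw.1 (by simp)
    have hjw : j.1 ≤ w := hw.1 (by simp)
    rcases le_or_le_of_lt hc hlt with h' | h'
    · exact absurd (hjw.trans h') hj'.2
    · exact absurd (hiw.trans h') hi'.2
  · exact hw

/-! ### The labeling of a regular vine -/

section JoinLabel

variable {l : {x : P // IsMin x} → {x : P // IsMin x} → ℕ}

theorem two_le_rk_of_isLUB (h : IsRVine rk) {i j : {x : P // IsMin x}} (hij : i ≠ j) {u : P}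
    (hu : IsLUB {i.1, j.1} u) : 2 ≤ rk u := by
  by_contra h2
  have hm : IsMin u := h.graded.isMin_iff.2 (by have := h.graded.one_le u; omega)
  exact hij (Subtype.ext ((hm.eq_of_le (hu.1 (by simp))).trans (hm.eq_of_le (hu.1 (by simp))).symm))

theorem joinLabel_lt (h : IsRVine rk)
    (hl : ∀ i j u, i ≠ j → IsLUB {i.1, j.1} u → l i j = rk u - 1)
    {c d i j : {x : P // IsMin x}} (hcd : c ≠ d) (hij : i ≠ j) {x u : P}
    (hu : IsLUB {i.1, j.1} u) (hx : x < u) (hc : c ∈ minsBelow x) (hd : d ∈ minsBelow x) :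
    l c d < l i j := by
  obtain ⟨w, hw⟩ := h.exists_isLUB c d
  have hwx : w ≤ x := hw.2 (by rintro _ (rfl | rfl); exacts [hc, hd])
  have h₁ := h.graded.lt _ _ (hwx.trans_lt hx)
  have h₂ := h.two_le_rk_of_isLUB hcd hw
  rw [hl c d w hcd hw, hl i j u hij hu]
  omega

/-- For the pair `i, j` of `exists_isLUB_of_minimal`, all other minimal elements below the join of
`i` and `j` form with `i` and `j` edges of smaller label. -/
theorem joinLabel_lt_of_mem (h : IsRVine rk)
    (hl : ∀ i j u, i ≠ j → IsLUB {i.1, j.1} u → l i j = rk u - 1)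
    {i j c : {x : P // IsMin x}} (hij : i ≠ j) {x y u : P} (hu : IsLUB {i.1, j.1} u)
    (hx : x < u) (hy : y < u) (hj : minsBelow u \ minsBelow x = {j})
    (hi : minsBelow u \ minsBelow y = {i}) (hc : c ∈ minsBelow u) (hci : c ≠ i) (hcj : c ≠ j) :
    l i c < l i j ∧ l c j < l i j := by
  have hiu : i ∈ minsBelow u := hu.1 (by simp)
  have hju : j ∈ minsBelow u := hu.1 (by simp)
  have mem : ∀ {z : P} {k d}, minsBelow u \ minsBelow z = {k} → d ∈ minsBelow u → d ≠ k →
      d ∈ minsBelow z := by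
    intro z k d hk hd hne
    by_contra hdz
    have : d ∈ minsBelow u \ minsBelow z := ⟨hd, hdz⟩
    rw [hk] at this
    exact hne this
  exact ⟨h.joinLabel_lt hl hci.symm hij hu hx (mem hj hiu hij) (mem hj hc hcj),
    h.joinLabel_lt hl hcj hij hu hy (mem hi hc hci) (mem hi hju hij.symm)⟩

theorem exists_minimal_upperBound (h : IsRVine rk) {S : Set {x : P // IsMin x}}
    (hS : S.Nontrivial) : ∃ u, S ⊆ minsBelow u ∧ ∀ w < u, ¬ S ⊆ minsBelow w := by
  obtain ⟨i, -⟩ := hS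
  have hne : Nonempty P := ⟨i.1⟩
  obtain ⟨t, ht, -⟩ := h.exists_top
  obtain ⟨u, hu⟩ := (Set.toFinite {u : P | S ⊆ minsBelow u}).exists_minimal ⟨t, fun i _ => ht i.1⟩
  exact ⟨u, hu.1, fun w hw hSw => hw.not_ge (hu.2 hSw hw.le)⟩

/-- The conditioning vertices of `{i, j}` are the other minimal elements below the join. -/
theorem condSet_joinLabel (h : IsRVine rk)
    (hl : ∀ i j u, i ≠ j → IsLUB {i.1, j.1} u → l i j = rk u - 1)
    {i j : {x : P // IsMin x}} (hij : i ≠ j) {u : P} (hu : IsLUB {i.1, j.1} u) :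
    condSet l i j = minsBelow u \ {i, j} := by
  have hsymm := joinLabel_symm hl h.exists_isLUB
  ext c
  rw [Set.mem_sdiff, Set.mem_insert_iff, Set.mem_singleton_iff, not_or]
  constructor
  · intro hc
    have hci : c ≠ i := by rintro rfl; exact IsMATLabeling.left_notMem_condSet _ _ hc
    have hcj : c ≠ j := by rintro rfl; exact IsMATLabeling.right_notMem_condSet _ _ hc
    refine ⟨?_, hci, hcj⟩
    have hS : ({i, j, c} : Set {x : P // IsMin x}).Nontrivial := ⟨i, by simp, j, by simp, hij⟩
    obtain ⟨v, hv, hvmin⟩ := h.exists_minimal_upperBound hS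
    obtain ⟨x, y, a, b, hx, hy, ha, hb, hab, hlub, hbx, hay⟩ :=
      h.exists_isLUB_of_minimal hS hv hvmin
    have hlt : ∀ d ∈ ({i, j, c} : Set {x : P // IsMin x}), d ≠ a → d ≠ b →
        l a d < l a b ∧ l d b < l a b := fun d hd hda hdb =>
      h.joinLabel_lt_of_mem hl hab hlub hx hy hbx hay (hv hd) hda hdb
    have h₁ := hc.1
    have h₂ := hc.2
    have hiv : i ∈ minsBelow v := hv (by simp)
    have hcv : c ∈ minsBelow v := hv (by simp)
    have e₁ := hsymm i j
    have e₂ := hsymm i c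
    have e₃ := hsymm j c
    -- the pair `a, b` carries the largest label of the triangle `i, j, c`, so it is `i, j`
    have hli := hlt i (by simp)
    have hlj := hlt j (by simp)
    rcases ha with rfl | rfl | rfl <;> rcases hb with rfl | rfl | rfl
    · exact absurd rfl hab
    · exact (hlub.unique hu) ▸ hcv
    · have := hlj hij.symm hcj.symm; omega
    · rw [Set.pair_comm] at hlub
      exact (hlub.unique hu) ▸ hcv
    · exact absurd rfl hab
    · have := hli hij hci.symm; omega
    · have := hlj hcj.symm hij.symm; omega
    · have := hli hci.symm hij; omega
    · exact absurd rfl hab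
  · rintro ⟨hcu, hci, hcj⟩
    have hS : ({i, j} : Set {x : P // IsMin x}).Nontrivial := ⟨i, by simp, j, by simp, hij⟩
    obtain ⟨x, y, a, b, hx, hy, ha, hb, hab, hlub, hbx, hay⟩ := h.exists_isLUB_of_minimal hS
      (pair_subset_minsBelow hu) (fun w hw hSw => hw.not_ge (hu.2 (by
        rintro _ (rfl | rfl)
        · exact hSw (Set.mem_insert _ _)
        · exact hSw (Set.mem_insert_of_mem _ rfl))))
    rcases ha with rfl | rfl <;> rcases hb with rfl | rfl
    · exact absurd rfl hab
    · exact h.joinLabel_lt_of_mem hl hab hlub hx hy hbx hay hcu hci hcj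
    · have := h.joinLabel_lt_of_mem hl hab hlub hx hy hbx hay hcu hcj hci
      rw [hsymm a c, hsymm c b, hsymm a b] at this
      exact ⟨this.2, this.1⟩
    · exact absurd rfl hab

/-- The largest label in a triangle is attained only once. -/
theorem joinLabel_lt_of_eq (h : IsRVine rk)
    (hl : ∀ i j u, i ≠ j → IsLUB {i.1, j.1} u → l i j = rk u - 1)
    {a b c : {x : P // IsMin x}} (hab : a ≠ b) (hac : a ≠ c) (hbc : b ≠ c)
    (heq : l a b = l a c) : l a b < l b c := by
  have hsymm := joinLabel_symm hl h.exists_isLUB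
  have hS : ({a, b, c} : Set {x : P // IsMin x}).Nontrivial := ⟨a, by simp, b, by simp, hab⟩
  obtain ⟨v, hv, hvmin⟩ := h.exists_minimal_upperBound hS
  obtain ⟨x, y, i, j, hx, hy, hi, hj, hij, hlub, hjx, hiy⟩ :=
    h.exists_isLUB_of_minimal hS hv hvmin
  have hlt : ∀ d ∈ ({a, b, c} : Set {x : P // IsMin x}), d ≠ i → d ≠ j →
      l i d < l i j ∧ l d j < l i j := fun d hd hdi hdj =>
    h.joinLabel_lt_of_mem hl hij hlub hx hy hjx hiy (hv hd) hdi hdj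
  have hla := hlt a (by simp)
  have hlb := hlt b (by simp)
  have hlc := hlt c (by simp)
  have e₁ := hsymm a b
  have e₂ := hsymm a c
  have e₃ := hsymm b c
  rcases hi with rfl | rfl | rfl <;> rcases hj with rfl | rfl | rfl
  · exact absurd rfl hij
  · have := hlc hac.symm hbc.symm; omega
  · have := hlb hab.symm hbc; omega
  · have := hlc hbc.symm hac.symm; omega
  · exact absurd rfl hij
  · have := hla hab hac; omega
  · have := hlb hbc hab.symm; omega
  · have := hla hac hab; omega
  · exact absurd rfl hij

theorem hasEliminationVertices_joinLabel (h : IsRVine rk)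
    (hl : ∀ i j u, i ≠ j → IsLUB {i.1, j.1} u → l i j = rk u - 1) :
    HasEliminationVertices l := by
  have hsymm := joinLabel_symm hl h.exists_isLUB
  intro S hS
  obtain ⟨v, hv, hvmin⟩ := h.exists_minimal_upperBound hS
  obtain ⟨x, -, -, j, -, -, -, hjS, -, -, hjx, -⟩ := h.exists_isLUB_of_minimal hS hv hvmin
  have hj' : j ∈ minsBelow v \ minsBelow x := hjx ▸ rfl
  refine ⟨j, hjS, fun c hc d hd hcj hdj hcd => ?_⟩
  have mem : ∀ d ∈ S, d ≠ j → d ∈ minsBelow x := by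
    intro d hd hne
    by_contra hdx
    have : d ∈ minsBelow v \ minsBelow x := ⟨hv hd, hdx⟩
    rw [hjx] at this
    exact hne this
  obtain ⟨w, hw⟩ := h.exists_isLUB c d
  have hwx : w ≤ x := hw.2 (by rintro _ (rfl | rfl); exacts [mem c hc hcj, mem d hd hdj])
  have hnot : j ∉ condSet l c d := by
    rw [h.condSet_joinLabel hl hcd hw]
    exact fun hjw => hj'.2 (minsBelow_mono hwx hjw.1)
  have hnot' : ¬ (l c j < l c d ∧ l j d < l c d) := hnot
  have e₁ := hsymm c j
  have e₂ := hsymm d j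
  have h₁ := h.joinLabel_lt_of_eq hl hcj.symm hdj.symm hcd
  have h₂ := h.joinLabel_lt_of_eq hl hcj hcd hdj.symm
  have h₃ := h.joinLabel_lt_of_eq hl hdj hcd.symm hcj.symm
  have e₃ := hsymm c d
  constructor
  · intro heq
    have := h₁ heq
    omega
  · by_contra! hle
    omega

/-- The labels `rk (i ∨ j) - 1` form an MAT-labeling of the complete graph on the minimal elements
of a regular vine. -/
theorem isMATLabeling_joinLabel (h : IsRVine rk) (h0 : ∀ i, l i i = 0)
    (hl : ∀ i j u, i ≠ j → IsLUB {i.1, j.1} u → l i j = rk u - 1) : IsMATLabeling l where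
  symm := joinLabel_symm hl h.exists_isLUB
  self := h0
  pos i j hij := by
    obtain ⟨u, hu⟩ := h.exists_isLUB i j
    have := h.two_le_rk_of_isLUB hij hu
    rw [hl i j u hij hu]
    omega
  not_reachable k a b hab hk :=
    (h.hasEliminationVertices_joinLabel hl).not_reachable _ hab hk
  ncard_condSet i j hij := by
    obtain ⟨u, hu⟩ := h.exists_isLUB i j
    rw [h.condSet_joinLabel hl hij hu, hl i j u hij hu, Set.ncard_sdiff
      (pair_subset_minsBelow hu) (Set.toFinite _), Set.ncard_pair hij, h.ncard_minsBelow]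
    omega

theorem pclique_joinLabel (h : IsRVine rk)
    (hl : ∀ i j u, i ≠ j → IsLUB {i.1, j.1} u → l i j = rk u - 1)
    {i j : {x : P // IsMin x}} (hij : i ≠ j) {u : P} (hu : IsLUB {i.1, j.1} u) :
    pclique l i j = minsBelow u := by
  rw [pclique, h.condSet_joinLabel hl hij hu]
  exact Set.union_sdiff_cancel (pair_subset_minsBelow hu)

end JoinLabel

/-- The elements of a regular vine are ordered like the sets of minimal elements below them. -/
theorem minsBelow_subset_iff (h : IsRVine rk) {v w : P} : minsBelow v ⊆ minsBelow w ↔ v ≤ w := by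
  refine ⟨fun hsub => ?_, minsBelow_mono⟩
  by_cases hv : IsMin v
  · exact hsub (a := ⟨v, hv⟩) le_rfl
  · have hnt : (minsBelow v).Nontrivial := by
      rw [← Set.one_lt_ncard_iff_nontrivial, h.ncard_minsBelow]
      have := h.graded.one_le v
      have := h.graded.isMin_iff (v := v)
      by_contra h1
      exact hv (this.2 (by omega))
    obtain ⟨-, -, i, j, -, -, hi, hj, -, hlub, -⟩ := h.exists_isLUB_of_minimal hnt subset_rfl
      (fun w hw hvw => by
        have := Set.ncard_le_ncard hvw (Set.toFinite _)
        rw [h.ncard_minsBelow, h.ncard_minsBelow] at this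
        have := h.graded.lt _ _ hw
        omega)
    exact hlub.2 (by rintro _ (rfl | rfl); exacts [hsub hi, hsub hj])

/-- A non-minimal element is the join of two distinct minimal elements. -/
theorem exists_isLUB_eq (h : IsRVine rk) {v : P} (hv : ¬ IsMin v) :
    ∃ i j : {x : P // IsMin x}, i ≠ j ∧ IsLUB {i.1, j.1} v := by
  obtain ⟨x, y, i, j, -, hx, hy, -, hij, hj, hi⟩ := h.exists_covers_and_mins hv
  have hnt : (minsBelow v).Nontrivial :=
    ⟨i, (hi ▸ rfl : i ∈ minsBelow v \ minsBelow y).1,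
      j, (hj ▸ rfl : j ∈ minsBelow v \ minsBelow x).1, hij⟩
  obtain ⟨-, -, i, j, -, -, -, -, hij, hlub, -⟩ := h.exists_isLUB_of_minimal hnt subset_rfl
    (fun w hw hvw => hw.not_ge (h.minsBelow_subset_iff.1 hvw))
  exact ⟨i, j, hij, hlub⟩

end IsRVine

end RVine

/-! ### Labeled complete graphs -/

namespace LabeledGraph

variable {G H : LabeledGraph.{u}}

open Classical in
/-- The label of the edge `{a, b}`, as a function on pairs of vertices; zero for non-adjacent
vertices. -/
noncomputable def lab (G : LabeledGraph.{u}) (a b : G.V) : ℕ :=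
  if h : G.graph.Adj a b then G.label ⟨s(a, b), h⟩ else 0

theorem lab_of_adj {a b : G.V} (h : G.graph.Adj a b) : G.lab a b = G.label ⟨s(a, b), h⟩ :=
  dif_pos h

theorem lab_self (a : G.V) : G.lab a a = 0 := dif_neg (G.graph.irrefl)

theorem lab_symm (a b : G.V) : G.lab a b = G.lab b a := by
  by_cases h : G.graph.Adj a b
  · rw [lab_of_adj h, lab_of_adj h.symm]
    exact congrArg G.label (Subtype.ext Sym2.eq_swap)
  · rw [lab, lab, dif_neg h, dif_neg fun h' => h h'.symm]

theorem edgesWith_adj (p : ℕ → Prop) (a b : G.V) :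
    (G.edgesWith p).Adj a b ↔ G.graph.Adj a b ∧ p (G.lab a b) := by
  rw [edgesWith, SimpleGraph.fromEdgeSet_adj]
  constructor
  · rintro ⟨⟨h, hp⟩, -⟩
    exact ⟨h, by rwa [lab_of_adj h]⟩
  · rintro ⟨h, hp⟩
    exact ⟨⟨h, by rwa [← lab_of_adj h]⟩, h.ne⟩

theorem adj_iff_of_eq_top (hG : G.graph = ⊤) {a b : G.V} : G.graph.Adj a b ↔ a ≠ b := by
  rw [hG, SimpleGraph.top_adj]

theorem level_eq (hG : G.graph = ⊤) (k : ℕ) : G.level k = levelGraph G.lab lab_symm k := by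
  ext a b
  rw [level, edgesWith_adj, adj_iff_of_eq_top hG]
  rfl

theorem condVertices_eq (hG : G.graph = ⊤) (a b : G.V) :
    G.condVertices (G.lab a b) a b = condSet G.lab a b := by
  ext h
  simp only [condVertices, below, edgesWith_adj, adj_iff_of_eq_top hG, condSet, Set.mem_ofPred_eq]
  constructor
  · rintro ⟨h₁, h₂⟩
    exact ⟨h₁.2, h₂.2⟩
  · rintro ⟨h₁, h₂⟩
    exact ⟨⟨by rintro rfl; exact lt_irrefl _ h₂, h₁⟩, by rintro rfl; exact lt_irrefl _ h₁, h₂⟩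

theorem principalClique_eq (hG : G.graph = ⊤) (a b : G.V) :
    G.principalClique (G.lab a b) a b = pclique G.lab a b := by
  rw [principalClique, condVertices_eq hG, pclique]

/-- An edge `{a, b}` lies on no cycle with edges of `L` if and only if its ends are not connected by
other edges of `L`. -/
theorem forall_cycle_notMem_iff {V : Type*} (L : SimpleGraph V) {a b : V} (hab : a ≠ b) :
    (∀ (w : V) (c : (L ⊔ SimpleGraph.edge a b).Walk w w), c.IsCycle → s(a, b) ∉ c.edges) ↔
      ¬ (L.deleteEdges {s(a, b)}).Reachable a b := by
  have he : s(a, b) ∈ (L ⊔ SimpleGraph.edge a b).edgeSet := by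
    simp [hab]
  have heq : (L ⊔ SimpleGraph.edge a b).deleteEdges {s(a, b)} = L.deleteEdges {s(a, b)} := by
    ext x y
    simp only [SimpleGraph.deleteEdges_adj, SimpleGraph.sup_adj, SimpleGraph.edge_adj,
      Set.mem_singleton_iff, Sym2.eq_iff]
    tauto
  rw [← heq, ← SimpleGraph.isBridge_iff, SimpleGraph.isBridge_iff_forall_cycle_notMem he]

theorem isMAT_iff (hG : G.graph = ⊤) : G.IsMAT ↔ IsMATLabeling G.lab := by
  constructor
  · intro h
    have hpos : ∀ a b, a ≠ b → 0 < G.lab a b := fun a b hab => by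
      rw [lab_of_adj ((adj_iff_of_eq_top hG).2 hab)]
      exact h.label_pos _
    refine ⟨lab_symm, lab_self, hpos, fun k a b hab hk => ?_, fun a b hab => ?_⟩
    · rw [← level_eq hG, ← forall_cycle_notMem_iff _ hab]
      refine h.no_cycle k ((hpos a b hab).trans_le hk) a b ?_
      rw [upTo, edgesWith_adj, adj_iff_of_eq_top hG]
      exact ⟨hab, hk⟩
    · rw [← condVertices_eq hG]
      refine h.triangles _ (hpos a b hab) a b ?_
      rw [level_eq hG]
      exact ⟨hab, rfl⟩
  · intro h
    refine ⟨?_, fun k hk a b hab => ?_, fun k hk a b hab => ?_⟩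
    · rintro ⟨e, he⟩
      induction e with
      | h a b =>
        have hab : G.graph.Adj a b := he
        have := h.pos a b hab.ne
        rwa [lab_of_adj hab] at this
    · rw [upTo, edgesWith_adj] at hab
      rw [forall_cycle_notMem_iff _ hab.1.ne, level_eq hG]
      exact h.not_reachable k a b hab.1.ne hab.2
    · rw [level_eq hG] at hab
      obtain ⟨hne, rfl⟩ := hab
      rw [condVertices_eq hG, h.ncard_condSet a b hne]

theorem isNode_iff (hG : MCG G) (s : Set G.V) : G.IsNode s ↔ IsClosedSet G.lab s ∧ s.Nonempty := by
  have := G.finite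
  rw [((isMAT_iff hG.1).1 hG.2).isClosedSet_and_nonempty_iff, IsNode]
  refine or_congr Iff.rfl ⟨?_, ?_⟩
  · rintro ⟨k, a, b, hab, rfl⟩
    rw [level_eq hG.1] at hab
    obtain ⟨hne, rfl⟩ := hab
    exact ⟨a, b, hne, principalClique_eq hG.1 a b⟩
  · rintro ⟨a, b, hab, rfl⟩
    refine ⟨G.lab a b, a, b, ?_, (principalClique_eq hG.1 a b).symm⟩
    rw [level_eq hG.1]
    exact ⟨hab, rfl⟩

theorem isMATLabeling_lab (hG : MCG G) : IsMATLabeling G.lab := (isMAT_iff hG.1).1 hG.2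

theorem Hom.ne (σ : Hom G H) (hG : MCG G) {a b : G.V} (hab : a ≠ b) : σ.toFun a ≠ σ.toFun b := by
  obtain ⟨h, -⟩ := σ.map_edge a b ((adj_iff_of_eq_top hG.1).2 hab)
  exact h.ne

theorem Hom.injective (σ : Hom G H) (hG : MCG G) : Function.Injective σ.toFun := fun a b h => by
  by_contra hab
  exact σ.ne hG hab h

theorem Hom.lab_eq (σ : Hom G H) (hG : MCG G) (a b : G.V) :
    H.lab (σ.toFun a) (σ.toFun b) = G.lab a b := by
  by_cases hab : a = b
  · rw [hab, lab_self, lab_self]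
  · have h := (adj_iff_of_eq_top hG.1).2 hab
    obtain ⟨h', he⟩ := σ.map_edge a b h
    rw [lab_of_adj h, lab_of_adj h', he]

/-- A label-preserving homomorphism maps conditioning vertices injectively to conditioning vertices,
and there are equally many of them. -/
theorem Hom.image_pclique (σ : Hom G H) (hG : MCG G) (hH : MCG H) {a b : G.V} (hab : a ≠ b) :
    σ.toFun '' pclique G.lab a b = pclique H.lab (σ.toFun a) (σ.toFun b) := by
  have := G.finite
  have := H.finite
  refine Set.eq_of_subset_of_ncard_le ?_ ?_ (Set.toFinite _)
  · rintro _ ⟨c, (rfl | rfl) | hc, rfl⟩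
    · exact IsMATLabeling.left_mem_pclique _ _
    · exact IsMATLabeling.right_mem_pclique _ _
    · refine IsMATLabeling.condSet_subset_pclique _ _ ⟨?_, ?_⟩
      · rw [σ.lab_eq hG, σ.lab_eq hG]; exact hc.1
      · rw [σ.lab_eq hG, σ.lab_eq hG]; exact hc.2
  · rw [Set.ncard_image_of_injective _ (σ.injective hG),
      (isMATLabeling_lab hG).ncard_pclique hab,
      (isMATLabeling_lab hH).ncard_pclique (σ.ne hG hab), σ.lab_eq hG]

theorem Hom.isNode_image (σ : Hom G H) (hG : MCG G) (hH : MCG H) {s : Set G.V}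
    (hs : G.IsNode s) : H.IsNode (σ.toFun '' s) := by
  have := G.finite
  have := H.finite
  rw [isNode_iff hG, (isMATLabeling_lab hG).isClosedSet_and_nonempty_iff] at hs
  rw [isNode_iff hH, (isMATLabeling_lab hH).isClosedSet_and_nonempty_iff]
  rcases hs with ⟨a, rfl⟩ | ⟨a, b, hab, rfl⟩
  · exact Or.inl ⟨σ.toFun a, Set.image_singleton⟩
  · exact Or.inr ⟨_, _, σ.ne hG hab, σ.image_pclique hG hH hab⟩

theorem Hom.isClosedSet_preimage (σ : Hom G H) (hG : MCG G) (hH : MCG H) {t : Set H.V}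
    (ht : IsClosedSet H.lab t) : IsClosedSet G.lab (σ.toFun ⁻¹' t) := by
  intro a ha b hb hab c hc
  refine ht.pclique_subset ha hb (σ.ne hG hab) ?_
  rw [← σ.image_pclique hG hH hab]
  exact Set.mem_image_of_mem _ (IsMATLabeling.condSet_subset_pclique _ _ hc)

/-- An isomorphism of labeled complete graphs from a bijection preserving labels. -/
def isoOfEquiv (hG : G.graph = ⊤) (hH : H.graph = ⊤) (e : G.V ≃ H.V)
    (he : ∀ a b, H.lab (e a) (e b) = G.lab a b) : G ≅ H where
  hom :=
    { toFun := e
      map_edge := fun a b h => by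
        have h' : H.graph.Adj (e a) (e b) := (adj_iff_of_eq_top hH).2 (e.injective.ne h.ne)
        exact ⟨h', by rw [← lab_of_adj h', ← lab_of_adj h, he]⟩ }
  inv :=
    { toFun := e.symm
      map_edge := fun a b h => by
        have h' : G.graph.Adj (e.symm a) (e.symm b) :=
          (adj_iff_of_eq_top hG).2 (e.symm.injective.ne h.ne)
        refine ⟨h', ?_⟩
        rw [← lab_of_adj h', ← lab_of_adj h, ← he, e.apply_symm_apply, e.apply_symm_apply] }
  hom_inv_id := Hom.ext (funext e.symm_apply_apply)
  inv_hom_id := Hom.ext (funext e.apply_symm_apply)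

end LabeledGraph

/-! ### The functor from labeled complete graphs to regular vines -/

open LabeledGraph

theorem rv_psiObj {G : LabeledGraph.{u}} (hG : MCG G) : RV (psiObj G) := by
  have := G.finite
  exact (isMATLabeling_lab hG).isRVine_node (isNode_iff hG)

/-- The map on nodes induced by a label-preserving homomorphism. Joins are preserved since the
preimage of a closed set is closed. -/
def psiMap {G H : LabeledGraph.{u}} (hG : MCG G) (hH : MCG H) (σ : LabeledGraph.Hom G H) :
    RankedPoset.Hom (psiObj G) (psiObj H) where
  toFun s := ⟨σ.toFun '' s.1, σ.isNode_image hG hH s.2⟩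
  monotone := fun _ _ h => Set.image_mono h
  map_rk := fun s => Set.ncard_image_of_injective s.1 (σ.injective hG)
  map_join := by
    intro x y v hv
    have hxv : x ≤ v := hv.1 (Set.mem_insert _ _)
    have hyv : y ≤ v := hv.1 (Set.mem_insert_of_mem _ rfl)
    refine ⟨?_, fun w hw => ?_⟩
    · rintro _ (rfl | rfl)
      · exact Set.image_mono hxv
      · exact Set.image_mono hyv
    · have hxw : σ.toFun '' x.1 ⊆ w.1 := hw (Set.mem_insert _ _)
      have hyw : σ.toFun '' y.1 ⊆ w.1 := hw (Set.mem_insert_of_mem _ rfl)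
      rw [Set.image_subset_iff] at hxw hyw
      have hnode : G.IsNode (σ.toFun ⁻¹' w.1) := (isNode_iff hG _).2
        ⟨σ.isClosedSet_preimage hG hH ((isNode_iff hH _).1 w.2).1,
          ((isNode_iff hG _).1 x.2).2.mono hxw⟩
      have hvw : v ≤ (⟨σ.toFun ⁻¹' w.1, hnode⟩ : (psiObj G).P) := hv.2 (by
        rintro _ (rfl | rfl)
        · exact hxw
        · exact hyw)
      exact Set.image_subset_iff.2 hvw

theorem psiRestricts : PsiRestricts MCG.{u} RV.{u} where
  obj _ hG := rv_psiObj hG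
  map _ _ hG hH σ := ⟨psiMap hG hH σ, fun _ => rfl⟩

/-! ### The functor from regular vines to labeled complete graphs -/

section Omega

variable {P Q : RankedPoset.{u}}

theorem omegaObj_label {i j : {x : P.P // IsMin x}} (h : (omegaGraph P).Adj i j) {v : P.P}
    (hv : IsLUB {i.1, j.1} v) : (omegaObj P).label ⟨s(i, j), h⟩ = P.rk v - 1 := by
  have hc := (omegaGraph_exists_join P s(i, j) h).choose_spec
  have hset : {x | ∃ k ∈ s(i, j), k.1 = x} = ({i.1, j.1} : Set P.P) := by
    ext x
    simp [eq_comm]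
  rw [← hset] at hv
  rw [hv.unique hc]
  rfl

theorem omegaObj_lab {i j : {x : P.P // IsMin x}} {v : P.P} (hij : i ≠ j)
    (hv : IsLUB {i.1, j.1} v) : (omegaObj P).lab i j = P.rk v - 1 := by
  have h : (omegaGraph P).Adj i j := ⟨hij, v, hv⟩
  exact (lab_of_adj (G := omegaObj P) h).trans (omegaObj_label h hv)

theorem omegaObj_graph (hP : RV P) : (omegaObj P).graph = ⊤ := by
  have := P.finite
  ext i j
  rw [SimpleGraph.top_adj]
  exact ⟨fun h => h.ne, fun h => ⟨h, IsRVine.exists_isLUB hP i j⟩⟩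

theorem mcg_omegaObj (hP : RV P) : MCG (omegaObj P) := by
  have := P.finite
  exact ⟨omegaObj_graph hP, (isMAT_iff (omegaObj_graph hP)).2
    (IsRVine.isMATLabeling_joinLabel hP (lab_self (G := omegaObj P)) fun _ _ _ => omegaObj_lab)⟩

theorem pclique_omegaObj (hP : RV P) {i j : {x : P.P // IsMin x}} {v : P.P} (hij : i ≠ j)
    (hv : IsLUB {i.1, j.1} v) : pclique (omegaObj P).lab i j = minsBelow v := by
  have := P.finite
  exact IsRVine.pclique_joinLabel hP (fun _ _ _ => omegaObj_lab) hij hv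

theorem RankedPoset.Hom.isMin (φ : RankedPoset.Hom P Q) (hP : RV P) (hQ : RV Q) {i : P.P}
    (hi : IsMin i) : IsMin (φ.toFun i) := by
  have := Q.finite
  have hr : P.rk i = 1 := (IsRVine.graded hP).isMin i hi
  exact (IsRVine.graded hQ).isMin_iff.2 ((φ.map_rk i).trans hr)

/-- If two distinct minimal elements had the same image, their join would be mapped to this image,
of rank one. -/
theorem RankedPoset.Hom.injective_on_isMin (φ : RankedPoset.Hom P Q) (hP : RV P)
    {i j : {x : P.P // IsMin x}} (hij : φ.toFun i.1 = φ.toFun j.1) : i = j := by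
  have := P.finite
  by_contra hne
  obtain ⟨v, hv⟩ := IsRVine.exists_isLUB hP i j
  have h2 : 2 ≤ P.rk v := IsRVine.two_le_rk_of_isLUB hP hne hv
  have hφ := φ.map_join _ _ _ hv
  rw [← hij, Set.pair_eq_singleton] at hφ
  have h1 : P.rk i.1 = 1 := (IsRVine.graded hP).isMin _ i.2
  rw [← φ.map_rk, hφ.unique isLUB_singleton, φ.map_rk, h1] at h2
  omega

/-- The map on minimal elements induced by a morphism of regular vines. -/
def omegaMap (hP : RV P) (hQ : RV Q) (φ : RankedPoset.Hom P Q) :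
    LabeledGraph.Hom (omegaObj P) (omegaObj Q) where
  toFun i := ⟨φ.toFun i.1, φ.isMin hP hQ i.2⟩
  map_edge := by
    rintro i j ⟨hij, v, hv⟩
    have hne : (⟨φ.toFun i.1, φ.isMin hP hQ i.2⟩ : {x : Q.P // IsMin x}) ≠
        ⟨φ.toFun j.1, φ.isMin hP hQ j.2⟩ := fun e =>
      hij (φ.injective_on_isMin hP (congrArg Subtype.val e))
    refine ⟨⟨hne, φ.toFun v, φ.map_join _ _ _ hv⟩, ?_⟩
    refine (omegaObj_label _ (φ.map_join _ _ _ hv)).trans ?_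
    rw [φ.map_rk]
    exact (omegaObj_label ⟨hij, v, hv⟩ hv).symm

theorem omegaRestricts : OmegaRestricts RV.{u} MCG.{u} where
  obj _ hP := mcg_omegaObj hP
  map _ _ hP hQ φ := ⟨omegaMap hP hQ φ, fun _ => rfl⟩

end Omega

/-! ### The two functors are mutually inverse up to natural isomorphism -/

/-- An isomorphism of ranked posets from an order isomorphism preserving ranks. -/
def RankedPoset.isoOfOrderIso {P Q : RankedPoset.{u}} (e : P.P ≃o Q.P)
    (he : ∀ x, Q.rk (e x) = P.rk x) : P ≅ Q where
  hom :=
    { toFun := e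
      monotone := e.monotone
      map_rk := he
      map_join := fun x y v hv => by
        rw [← Set.image_pair]
        exact e.isLUB_image'.2 hv }
  inv :=
    { toFun := e.symm
      monotone := e.symm.monotone
      map_rk := fun x => by rw [← he, e.apply_symm_apply]
      map_join := fun x y v hv => by
        rw [← Set.image_pair]
        exact e.symm.isLUB_image'.2 hv }
  hom_inv_id := RankedPoset.Hom.ext (funext e.symm_apply_apply)
  inv_hom_id := RankedPoset.Hom.ext (funext e.apply_symm_apply)

theorem isNode_minsBelow {P : RankedPoset.{u}} (hP : RV P) (v : P.P) :
    (omegaObj P).IsNode (minsBelow v) := by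
  have := P.finite
  have hfin := (omegaObj P).finite
  refine (isNode_iff (mcg_omegaObj hP) _).2
    ((isMATLabeling_lab (mcg_omegaObj hP)).isClosedSet_and_nonempty_iff.2 ?_)
  by_cases hv : IsMin v
  · exact Or.inl ⟨⟨v, hv⟩, minsBelow_of_isMin hv⟩
  · obtain ⟨i, j, hij, hlub⟩ := IsRVine.exists_isLUB_eq hP hv
    exact Or.inr ⟨i, j, hij, (pclique_omegaObj hP hij hlub).symm⟩

/-- A regular vine is isomorphic to the poset of nodes of its labeled graph, an element
corresponding to the set of minimal elements below it. -/
noncomputable def minsBelowIso {P : RankedPoset.{u}} (hP : RV P) :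
    P.P ≃o (psiObj (omegaObj P)).P := by
  have := P.finite
  have hfin := (omegaObj P).finite
  refine OrderIso.ofSurjective (OrderEmbedding.ofMapLEIff
    (fun v => (⟨minsBelow v, isNode_minsBelow hP v⟩ : (psiObj (omegaObj P)).P))
    (fun v w => IsRVine.minsBelow_subset_iff hP)) ?_
  rintro ⟨s, hs⟩
  have hs' := (isMATLabeling_lab (mcg_omegaObj hP)).isClosedSet_and_nonempty_iff.1
    ((isNode_iff (mcg_omegaObj hP) _).1 hs)
  rcases hs' with ⟨i, rfl⟩ | ⟨i, j, hij, rfl⟩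
  · exact ⟨i.1, Subtype.ext (minsBelow_of_isMin i.2)⟩
  · obtain ⟨v, hv⟩ := IsRVine.exists_isLUB hP i j
    exact ⟨v, Subtype.ext (pclique_omegaObj hP hij hv).symm⟩

theorem minsBelow_map {P Q : RankedPoset.{u}} (hP : RV P) (hQ : RV Q) (φ : RankedPoset.Hom P Q)
    (v : P.P) : (omegaMap hP hQ φ).toFun '' minsBelow v = minsBelow (φ.toFun v) := by
  have := P.finite
  have := Q.finite
  have hfin := (omegaObj Q).finite
  refine Set.eq_of_subset_of_ncard_le ?_ ?_ (Set.toFinite _)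
  · rintro _ ⟨i, hi, rfl⟩
    exact φ.monotone hi
  · have h₀ : ((omegaMap hP hQ φ).toFun '' minsBelow v).ncard = (minsBelow v).ncard :=
      Set.ncard_image_of_injective _ ((omegaMap hP hQ φ).injective (mcg_omegaObj hP))
    have h₁ : (minsBelow v).ncard = P.rk v := IsRVine.ncard_minsBelow hP v
    have h₂ : (minsBelow (φ.toFun v)).ncard = Q.rk (φ.toFun v) := IsRVine.ncard_minsBelow hQ _
    exact (h₂.trans ((φ.map_rk v).trans (h₁.symm.trans h₀.symm))).le

/-- The natural isomorphism from the identity to `Ψ ∘ Ω`. -/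
noncomputable def omegaPsiIso (hΨ : PsiRestricts MCG.{u} RV.{u})
    (hΩ : OmegaRestricts RV.{u} MCG.{u}) :
    𝟭 RV.{u}.FullSubcategory ≅ hΩ.functor ⋙ hΨ.functor :=
  NatIso.ofComponents
    (fun P => RV.isoMk (RankedPoset.isoOfOrderIso (minsBelowIso P.property) fun v => by
      have := P.obj.finite
      exact IsRVine.ncard_minsBelow P.property v))
    (by
      intro P Q φ
      apply ObjectProperty.hom_ext
      apply RankedPoset.Hom.ext
      funext v
      apply Subtype.ext
      have h₁ := (hΨ.map _ _ (hΩ.obj _ P.property) (hΩ.obj _ Q.property)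
        (hΩ.functor.map φ).hom).choose_spec (minsBelowIso P.property v)
      refine Eq.trans ?_ h₁.symm
      have h₂ : (hΩ.functor.map φ).hom = omegaMap P.property Q.property φ.hom :=
        LabeledGraph.Hom.ext (funext fun i => Subtype.ext
          ((hΩ.map _ _ P.property Q.property φ.hom).choose_spec i))
      rw [h₂]
      exact (minsBelow_map P.property Q.property φ.hom v).symm)

/-- The vertices of a labeled complete graph are the minimal nodes. -/
noncomputable def singletonEquiv {G : LabeledGraph.{u}} (hG : MCG G) :
    G.V ≃ (omegaObj (psiObj G)).V := by
  have := G.finite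
  refine Equiv.ofBijective (fun a => ⟨⟨{a}, Or.inl ⟨a, rfl⟩⟩,
    (IsMATLabeling.node_isMin_iff (isNode_iff hG)).2 (Set.ncard_singleton a)⟩)
    ⟨fun a b h => ?_, fun X => ?_⟩
  · exact Set.singleton_injective (congrArg (fun X => X.1.1) h)
  · obtain ⟨a, ha⟩ := Set.ncard_eq_one.1
      ((IsMATLabeling.node_isMin_iff (isNode_iff hG)).1 X.2)
    exact ⟨a, Subtype.ext (Subtype.ext ha.symm)⟩

theorem lab_singletonEquiv {G : LabeledGraph.{u}} (hG : MCG G) (a b : G.V) :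
    (omegaObj (psiObj G)).lab (singletonEquiv hG a) (singletonEquiv hG b) = G.lab a b := by
  have := G.finite
  by_cases hab : a = b
  · rw [hab, lab_self, lab_self]
  have hnode : G.IsNode (pclique G.lab a b) := (isNode_iff hG _).2
    ((isMATLabeling_lab hG).isClosedSet_and_nonempty_iff.2 (Or.inr ⟨a, b, hab, rfl⟩))
  have hlub : IsLUB {(singletonEquiv hG a).1, (singletonEquiv hG b).1}
      (⟨pclique G.lab a b, hnode⟩ : (psiObj G).P) := by
    refine ⟨?_, fun w hw => ?_⟩
    · rintro _ (rfl | rfl)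
      · exact Set.singleton_subset_iff.2 (IsMATLabeling.left_mem_pclique a b)
      · exact Set.singleton_subset_iff.2 (IsMATLabeling.right_mem_pclique a b)
    · have ha : ({a} : Set G.V) ⊆ w.1 := hw (Set.mem_insert _ _)
      have hb : ({b} : Set G.V) ⊆ w.1 := hw (Set.mem_insert_of_mem _ rfl)
      exact ((isNode_iff hG _).1 w.2).1.pclique_subset (ha rfl) (hb rfl) hab
  rw [omegaObj_lab ((singletonEquiv hG).injective.ne hab) hlub]
  have hrk : (psiObj G).rk ⟨pclique G.lab a b, hnode⟩ = G.lab a b + 1 :=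
    (isMATLabeling_lab hG).ncard_pclique hab
  rw [hrk]
  rfl

/-- The natural isomorphism from the identity to `Ω ∘ Ψ`. -/
noncomputable def psiOmegaIso (hΨ : PsiRestricts MCG.{u} RV.{u})
    (hΩ : OmegaRestricts RV.{u} MCG.{u}) :
    𝟭 MCG.{u}.FullSubcategory ≅ hΨ.functor ⋙ hΩ.functor :=
  NatIso.ofComponents
    (fun G => MCG.isoMk (LabeledGraph.isoOfEquiv G.property.1
      (hΩ.obj _ (hΨ.obj _ G.property)).1 (singletonEquiv G.property)
      (lab_singletonEquiv G.property)))
    (by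
      intro G H σ
      apply ObjectProperty.hom_ext
      apply LabeledGraph.Hom.ext
      funext a
      apply Subtype.ext
      have h₁ := (hΩ.map _ _ (hΨ.obj _ G.property) (hΨ.obj _ H.property)
        (hΨ.functor.map σ).hom).choose_spec (singletonEquiv G.property a)
      refine Eq.trans ?_ h₁.symm
      apply Subtype.ext
      have h₂ := (hΨ.map _ _ G.property H.property σ.hom).choose_spec
        (singletonEquiv G.property a).1
      refine Eq.trans ?_ h₂.symm
      exact Set.image_singleton.symm)

theorem mainTheorem2 :
    ∃ (hΨ : PsiRestricts MCG.{u} RV.{u}) (hΩ : OmegaRestricts RV.{u} MCG.{u}),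
      Nonempty (hΩ.functor ⋙ hΨ.functor ≅ 𝟭 RV.{u}.FullSubcategory) ∧
      Nonempty (hΨ.functor ⋙ hΩ.functor ≅ 𝟭 MCG.{u}.FullSubcategory) ∧
      Nonempty (MCG.{u}.FullSubcategory ≌ RV.{u}.FullSubcategory) :=
  ⟨psiRestricts, omegaRestricts, ⟨(omegaPsiIso _ _).symm⟩, ⟨(psiOmegaIso _ _).symm⟩,
    ⟨CategoryTheory.Equivalence.mk psiRestricts.functor omegaRestricts.functor
      (psiOmegaIso _ _) (omegaPsiIso _ _).symm⟩⟩
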